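/- Fix $d\ge 3$. For a graph $G$ whose vertex set carries a probability measure (the uniform one if $G$ is finite and nonempty) and a measurable coloring $f:V(G)\to[k]=\{1,\dots,k\}$, let $\mu_{r,G,f}$ be the distribution of the isomorphism class of the rooted colored ball $(N_r(v),v,f|_{N_r(v)})$ of radius $r$ around a random vertex $v$, and let $Q_{r,G,k}$ be the set of all $\mu_{r,G,f}$ with $f:V(G)\to[k]$ measurable. Let $d_H$ be the Hausdorff distance of sets of probability measures with respect to the total variation distance $d_{TV}(\mu,\nu)=\sup_A|\mu(A)-\nu(A)|$. Let $X_d$ be the set of finite nonempty graphs with all degrees at most $d$, with the colored neighborhood (pseudo)metric $$d_{CN}(G,G')=\sum_{k=1}^\infty\sum_{r=1}^\infty 2^{-k-r}\,d_H(Q_{r,G,k},Q_{r,G',k}),$$ and let $\overline{X_d}$ be its completion; its topology is the local-global topology. A graphing is a graph $\mathcal G$ with all degrees at most $d$ on a Polish space $\Omega$ with a Borel probability measure $\nu$, with Borel edge set in $\Omega\times\Omega$, such that $\int_A e(x,B)\,d\nu(x)=\int_B e(x,A)\,d\nu(x)$ for all Borel sets $A,B\subseteq\Omega$, where $e(x,S)$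 is the number of edges from $x$ to $S$. Finite graphs $G_i\in X_d$ converge locally-globally to $\mathcal G$ if $d_H(Q_{r,G_i,k},Q_{r,\mathcal G,k})\to 0$ for all $r,k\ge 1$. A graphing $\mathcal G$ represents a point $x\in\overline{X_d}$ if some sequence in $X_d$ converges to $x$ in $\overline{X_d}$ and converges locally-globally to $\mathcal G$; a subset of $\overline{X_d}$ contains $\mathcal G$ if it contains a point represented by $\mathcal G$. A graphing $\mathcal G$ is typical if there is an infinite set $S'$ of positive integers, such that for each $i\in S'$ there is a $d$-regular simple graph on $i$ vertices, with the following property: if $\mathbb H_i$ ($i\in S'$) are independent and $\mathbb H_i$ is uniformly distributed on the $d$-regular simple graphs on $i$ labelled vertices, then $(\mathbb H_i)_{i\in S'}$ converges locally-globally to $\mathcal G$ with probability $1$. **Proposition.** Let $(n_i)_{i\in\mathbb N}$ be a sequence of positive integers with $n_i\to\infty$, and let $(\mathbb G_i)_{i\in\mathbb N}$ be a sequence of independent random graphs such that $\mathbb G_i$ is uniformly distributed on the (nonempty) set of $d$-regular simple graphs on $n_i$ labelled vertices. Let $C$ be a closed subset of $\overline{X_d}$ with respect to the local-global topology, and suppose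 that $C$ does not contain any typical graphing. Then $\mathbb P(\mathbb G_i\in C)\to 0$ as $i\to\infty$. -/

import Mathlib

open MeasureTheory ProbabilityTheory Filter Topology
open scoped ENNReal UniformConvergence

noncomputable section

namespace LocalGlobal

/-! ### Rooted coloured graphs up to isomorphism -/

/-- A rooted graph with a (not necessarily proper) colouring of its vertices by `k` colours. -/
structure RootedColoredGraph (k : ℕ) : Type 1 where
  V : Type
  graph : SimpleGraph V
  root : V
  color : V → Fin k

/-- Isomorphism of rooted coloured graphs: a graph isomorphism which preserves roots and colours. -/
def RootedColoredGraph.Equivalent {k : ℕ} (H K : RootedColoredGraph k) : Prop :=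
  ∃ e : H.graph ≃g K.graph, e H.root = K.root ∧ ∀ v, K.color (e v) = H.color v

instance RootedColoredGraph.setoid (k : ℕ) : Setoid (RootedColoredGraph k) where
  r := RootedColoredGraph.Equivalent
  iseqv :=
    { refl := fun _ => ⟨RelIso.refl _, rfl, fun _ => rfl⟩
      symm := fun {H K} ⟨e, h1, h2⟩ =>
        ⟨e.symm, by rw [← h1]; exact e.symm_apply_apply _, fun v => by
          rw [← h2 (e.symm v)]; exact congrArg K.color (e.apply_symm_apply v)⟩
      trans := fun ⟨e, h1, h2⟩ ⟨e', h1', h2'⟩ =>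
        ⟨e.trans e', by simp [h1, h1'], fun v => by simp [h2, h2']⟩ }

/-- Isomorphism classes of rooted `k`-coloured graphs. -/
abbrev RootedClass (k : ℕ) : Type 1 := Quotient (RootedColoredGraph.setoid k)

/-- The vertices at graph distance at most `r` from `v` (`edist` is `⊤` between components). -/
def ball {V : Type} (G : SimpleGraph V) (r : ℕ) (v : V) : Set V := {w | G.edist v w ≤ r}

/-- The isomorphism class of the coloured neighbourhood `N_r(v)`: the subgraph induced on the ball
of radius `r` about `v`, rooted at `v`, with the restriction of the colouring `f`. -/
def neighborhoodClass {V : Type} (G : SimpleGraph V) (r : ℕ) {k : ℕ} (f : V → Fin k) (v : V) :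
    RootedClass k :=
  Quotient.mk _
    { V := ball G r v
      graph := G.induce (ball G r v)
      root := ⟨v, by simp [ball]⟩
      color := fun w => f w }

/-! ### Local statistics -/

/-- Distributions of random rooted `k`-coloured graphs, recorded as set functions
`A ↦ μ A ∈ [0, 1]`. The distance is the uniform one, `sup_A |μ A - ν A|` (see `dist_statistic`),
i.e. the total variation distance. -/
abbrev Statistic (k : ℕ) : Type 1 := Set (RootedClass k) →ᵤ unitInterval

theorem dist_statistic {k : ℕ} (p q : Statistic k) :
    dist p q = ⨆ A : Set (RootedClass k),
      |((UniformFun.toFun p A : unitInterval) : ℝ) - ((UniformFun.toFun q A : unitInterval) : ℝ)| :=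
  rfl

/-- The local statistics `μ_{r, G, f}` of the colouring `f`: the distribution of the coloured
`r`-neighbourhood of a `ν`-random vertex. -/
def localStatistic {V : Type} [MeasurableSpace V] (ν : Measure V) [IsProbabilityMeasure ν]
    (G : SimpleGraph V) (r : ℕ) {k : ℕ} (f : V → Fin k) : Statistic k :=
  UniformFun.ofFun fun A =>
    ⟨ν.real {v | neighborhoodClass G r f v ∈ A}, measureReal_nonneg, measureReal_le_one⟩

/-- The set `Q_{r, G, k}` of the local statistics of all measurable `k`-colourings of `G`. -/
def statisticSet {V : Type} [MeasurableSpace V] (ν : Measure V) [IsProbabilityMeasure ν]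
    (G : SimpleGraph V) (r k : ℕ) : Set (Statistic k) :=
  {p | ∃ f : V → Fin k, Measurable f ∧ p = localStatistic ν G r f}

/-! ### Finite graphs and the coloured neighbourhood metric -/

open Classical in
/-- The set `X_d` of finite (nonempty, labelled) graphs with all degrees at most `d`. -/
structure BoundedDegreeGraph (d : ℕ) where
  card : ℕ
  card_pos : 0 < card
  graph : SimpleGraph (Fin card)
  degree_le : ∀ v, graph.degree v ≤ d

namespace BoundedDegreeGraph

variable {d : ℕ}

instance (G : BoundedDegreeGraph d) : Nonempty (Fin G.card) := ⟨⟨0, G.card_pos⟩⟩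

/-- `Q_{r, G, k}` for a finite graph: the random vertex is uniform; every colouring of the finite
vertex set is measurable. -/
def Q (G : BoundedDegreeGraph d) (r k : ℕ) : Set (Statistic k) :=
  statisticSet (uniformOn (Set.univ : Set (Fin G.card))) G.graph r k

/-- The coloured neighbourhood distance
`∑_{k ≥ 1} ∑_{r ≥ 1} 2 ^ (-k - r) * d_H (Q_{r, G, k}, Q_{r, G', k})`; the summation indices are
shifted by one. -/
def distCN (G G' : BoundedDegreeGraph d) : ℝ :=
  ∑' k : ℕ, ∑' r : ℕ, (1 / 2 : ℝ) ^ ((k + 1) + (r + 1)) *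
    Metric.hausdorffDist (G.Q (r + 1) (k + 1)) (G'.Q (r + 1) (k + 1))

theorem Q_nonempty (G : BoundedDegreeGraph d) (r k : ℕ) : (G.Q r (k + 1)).Nonempty :=
  ⟨_, fun _ => 0, measurable_const, rfl⟩

theorem dist_statistic_le_one {k : ℕ} (p q : Statistic k) : dist p q ≤ 1 := by
  rw [dist_statistic]
  refine Real.iSup_le (fun A => ?_) zero_le_one
  have h1 := (UniformFun.toFun p A : unitInterval).2
  have h2 := (UniformFun.toFun q A : unitInterval).2
  rw [abs_le]
  constructor <;> linarith [h1.1, h1.2, h2.1, h2.2]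

theorem isBounded_statistic {k : ℕ} (s : Set (Statistic k)) : Bornology.IsBounded s :=
  Metric.isBounded_iff.2 ⟨1, fun _ _ _ _ => dist_statistic_le_one _ _⟩

theorem hausdorffDist_le_one (G G' : BoundedDegreeGraph d) (r k : ℕ) :
    Metric.hausdorffDist (G.Q r (k + 1)) (G'.Q r (k + 1)) ≤ 1 := by
  obtain ⟨p, hp⟩ := G.Q_nonempty r k
  obtain ⟨q, hq⟩ := G'.Q_nonempty r k
  exact Metric.hausdorffDist_le_of_mem_dist zero_le_one
    (fun x _ => ⟨q, hq, dist_statistic_le_one _ _⟩)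
    (fun x _ => ⟨p, hp, dist_statistic_le_one _ _⟩)

theorem hausdorffDist_Q_triangle (G G' G'' : BoundedDegreeGraph d) (r k : ℕ) :
    Metric.hausdorffDist (G.Q r (k + 1)) (G''.Q r (k + 1)) ≤
      Metric.hausdorffDist (G.Q r (k + 1)) (G'.Q r (k + 1)) +
        Metric.hausdorffDist (G'.Q r (k + 1)) (G''.Q r (k + 1)) :=
  Metric.hausdorffDist_triangle
    (Metric.hausdorffEDist_ne_top_of_nonempty_of_bounded (G.Q_nonempty r k) (G'.Q_nonempty r k)
      (isBounded_statistic _) (isBounded_statistic _))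

theorem summable_geom : Summable fun k : ℕ => (1 / 2 : ℝ) ^ (k + 1) :=
  (summable_nat_add_iff 1).2 summable_geometric_two

theorem term_le (G G' : BoundedDegreeGraph d) (k r : ℕ) :
    (1 / 2 : ℝ) ^ ((k + 1) + (r + 1)) *
      Metric.hausdorffDist (G.Q (r + 1) (k + 1)) (G'.Q (r + 1) (k + 1)) ≤
    (1 / 2 : ℝ) ^ (k + 1) * (1 / 2 : ℝ) ^ (r + 1) := by
  rw [← pow_add]
  exact mul_le_of_le_one_right (by positivity) (hausdorffDist_le_one G G' _ _)

theorem term_nonneg (G G' : BoundedDegreeGraph d) (k r : ℕ) :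
    0 ≤ (1 / 2 : ℝ) ^ ((k + 1) + (r + 1)) *
      Metric.hausdorffDist (G.Q (r + 1) (k + 1)) (G'.Q (r + 1) (k + 1)) :=
  mul_nonneg (by positivity) Metric.hausdorffDist_nonneg

theorem summable_inner (G G' : BoundedDegreeGraph d) (k : ℕ) :
    Summable fun r : ℕ => (1 / 2 : ℝ) ^ ((k + 1) + (r + 1)) *
      Metric.hausdorffDist (G.Q (r + 1) (k + 1)) (G'.Q (r + 1) (k + 1)) :=
  Summable.of_nonneg_of_le (term_nonneg G G' k) (term_le G G' k) (summable_geom.mul_left _)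

theorem summable_outer (G G' : BoundedDegreeGraph d) :
    Summable fun k : ℕ => ∑' r : ℕ, (1 / 2 : ℝ) ^ ((k + 1) + (r + 1)) *
      Metric.hausdorffDist (G.Q (r + 1) (k + 1)) (G'.Q (r + 1) (k + 1)) := by
  refine Summable.of_nonneg_of_le (fun k => tsum_nonneg (term_nonneg G G' k))
    (fun k => (summable_inner G G' k).tsum_le_tsum (term_le G G' k) (summable_geom.mul_left _)) ?_
  simp_rw [tsum_mul_left]
  exact summable_geom.mul_right _

/-- `X_d` with the coloured neighbourhood distance. -/
instance : PseudoMetricSpace (BoundedDegreeGraph d) where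
  dist := distCN
  dist_self G := by simp [distCN]
  dist_comm G G' := by
    unfold distCN
    simp_rw [fun r k => Metric.hausdorffDist_comm (s := G.Q r k) (t := G'.Q r k)]
  dist_triangle G G' G'' := by
    unfold distCN
    rw [← (summable_outer G G').tsum_add (summable_outer G' G'')]
    refine (summable_outer G G'').tsum_le_tsum (fun k => ?_)
      ((summable_outer G G').add (summable_outer G' G''))
    rw [← (summable_inner G G' k).tsum_add (summable_inner G' G'' k)]
    refine (summable_inner G G'' k).tsum_le_tsum (fun r => ?_)
      ((summable_inner G G' k).add (summable_inner G' G'' k))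
    rw [← mul_add]
    exact mul_le_mul_of_nonneg_left (hausdorffDist_Q_triangle G G' G'' _ _) (by positivity)

end BoundedDegreeGraph

/-- The completion of `X_d` with respect to the coloured neighbourhood metric. Its topology is the
local-global topology. (Graphs at distance `0` become equal in it.) -/
abbrev LimitSpace (d : ℕ) : Type := UniformSpace.Completion (BoundedDegreeGraph d)

/-! ### Graphings -/

/-- A graphing with degree bound `d`: a Borel graph on a Polish space with a Borel probability
measure `ν`, with all degrees at most `d`, such that `∫_A e(x, B) dν = ∫_B e(x, A) dν` for all Borel
sets `A`, `B`, where `e(x, S)` is the number of edges from `x` to `S`. -/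
structure Graphing (d : ℕ) : Type 1 where
  Ω : Type
  [topology : TopologicalSpace Ω]
  [polish : PolishSpace Ω]
  [measurable : MeasurableSpace Ω]
  [borel : BorelSpace Ω]
  ν : Measure Ω
  [isProb : IsProbabilityMeasure ν]
  graph : SimpleGraph Ω
  measurableSet_edges : MeasurableSet {p : Ω × Ω | graph.Adj p.1 p.2}
  degree_le : ∀ x, (graph.neighborSet x).encard ≤ d
  measure_preserving : ∀ A B : Set Ω, MeasurableSet A → MeasurableSet B →
    ∫⁻ x in A, ((graph.neighborSet x ∩ B).encard : ℝ≥0∞) ∂ν =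
      ∫⁻ x in B, ((graph.neighborSet x ∩ A).encard : ℝ≥0∞) ∂ν

attribute [instance] Graphing.topology Graphing.polish Graphing.measurable Graphing.borel
  Graphing.isProb

/-- `Q_{r, 𝒢, k}` for a graphing: the statistics of its measurable `k`-colourings. -/
def Graphing.Q {d : ℕ} (𝒢 : Graphing d) (r k : ℕ) : Set (Statistic k) :=
  statisticSet 𝒢.ν 𝒢.graph r k

/-- Local-global convergence of the finite graphs `G i` to the graphing `𝒢` along the filter `l`:
for all `r, k ≥ 1`, the sets `Q_{r, G i, k}` converge to `Q_{r, 𝒢, k}` in Hausdorff distance. -/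
def LGTendsto {d : ℕ} {ι : Type} (G : ι → BoundedDegreeGraph d) (l : Filter ι) (𝒢 : Graphing d) :
    Prop :=
  ∀ r k : ℕ, 1 ≤ r → 1 ≤ k →
    Tendsto (fun i => Metric.hausdorffDist ((G i).Q r k) (𝒢.Q r k)) l (𝓝 0)

/-- The graphing `𝒢` represents the point `x` of the completion of `X_d`: some sequence of finite
graphs which converges to `x` in the completion converges locally-globally to `𝒢`. -/
def Graphing.Represents {d : ℕ} (𝒢 : Graphing d) (x : LimitSpace d) : Prop :=
  ∃ G : ℕ → BoundedDegreeGraph d,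
    Tendsto (fun i => (G i : LimitSpace d)) atTop (𝓝 x) ∧ LGTendsto G atTop 𝒢

/-! ### Random regular graphs and typical graphings -/

open Classical in
/-- The `d`-regular simple graphs on the vertex set `Fin n`, `n ≥ 1`. -/
def RegularGraph (d n : ℕ) : Type :=
  {G : SimpleGraph (Fin n) // 0 < n ∧ G.IsRegularOfDegree d}

instance (d n : ℕ) : Finite (RegularGraph d n) := by
  unfold RegularGraph; infer_instance

instance (d n : ℕ) : MeasurableSpace (RegularGraph d n) := ⊤

instance (d n : ℕ) : DiscreteMeasurableSpace (RegularGraph d n) := ⟨fun _ => trivial⟩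

/-- A `d`-regular graph as an element of `X_d`. -/
def RegularGraph.toBounded {d n : ℕ} (G : RegularGraph d n) : BoundedDegreeGraph d where
  card := n
  card_pos := G.2.1
  graph := G.1
  degree_le v := (G.2.2 v).le

/-- The distribution of the uniform random `d`-regular graph on `n` labelled vertices (the zero
measure if there is no such graph). -/
def uniformRegular (d n : ℕ) : Measure (RegularGraph d n) := uniformOn Set.univ

instance (d n : ℕ) [Nonempty (RegularGraph d n)] : IsProbabilityMeasure (uniformRegular d n) := by
  unfold uniformRegular; infer_instance

/-- A graphing `𝒢` is typical if there is an infinite set `S` of positive integers (such that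
`d`-regular graphs on `n` vertices exist for each `n ∈ S`) such that independent uniform random
`d`-regular graphs `𝔾_n` on `n` vertices, `n ∈ S`, converge locally-globally to `𝒢` with
probability one. -/
def Graphing.IsTypical {d : ℕ} (𝒢 : Graphing d) : Prop :=
  ∃ S : Set ℕ, S.Infinite ∧ ∃ _ : ∀ n : S, Nonempty (RegularGraph d n),
    ∀ᵐ G ∂(Measure.infinitePi fun n : S => uniformRegular d n),
      LGTendsto (fun n : S => (G n).toBounded) atTop 𝒢

end LocalGlobal

end

/-! The proof is concentration plus compactness. For large n, a uniform d-regular graph on n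
vertices lies with high probability within δ of a deterministic point
(`RegularGraph.exists_center`). If P(𝔾_i ∈ C) stayed at least ε along a subsequence, these centres
would accumulate, by compactness of the completion, at some x. The graphs are close to x with
probability near 1 and lie in the closed set C with probability at least ε, so x ∈ C
(`exists_concentration_point`). Along a sparse set of sizes the probabilities of being far from x
are summable, and Borel–Cantelli gives almost sure convergence to x. A graphing representing x is
therefore typical (`exists_isTypical_represents`), against the assumption on C.

Two inputs carry this. The first is that every point of the completion is represented by a graphing
(`exists_represents`). A convergent sequence of finite graphs is decorated with matchings that
exhaust the edges, with separating labels, and with ε-nets of colourings. The code of a vertex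
records the labels seen along all words in the matchings. The closure of the codes is a compact
profinite space on which letters act by shifts, and a limit of the uniform vertex measures is
invariant. Neighbourhood classes are locally constant there, so statistics of continuous colourings
pass to the limit. The nets bring the statistics of every finite colouring close to those of a
continuous one, and measurable colourings of the limit are approximated by locally constant ones.

The second is exponential concentration. In the configuration model a transposition of half-edges
moves the distance from a fixed statistic to Q_{r,G,k} by O(1/n), so a martingale argument on
permutations (`sum_exp_perm_le`) bounds deviations by exp(-κn). Finitely many such distances control
the metric (`exists_controlling_net`). Passing to uniform regular graphs only needs that a
configuration is simple with subexponentially small probability at worst (`exists_regularRatio_ge`).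
This follows by comparing n with n + 2: delete d disjoint edges and join two new vertices to their
ends. -/

noncomputable section

namespace LocalGlobal

/-! ### Balls and graphs that agree locally -/

section Balls

variable {V : Type} {G : SimpleGraph V}

theorem mem_ball_self (r : ℕ) (v : V) : v ∈ ball G r v := by simp [ball]

theorem mem_ball_comm {r : ℕ} {v w : V} : w ∈ ball G r v ↔ v ∈ ball G r w := by
  simp [ball, SimpleGraph.edist_comm]

theorem ball_zero (v : V) : ball G 0 v = {v} := by
  ext w
  rw [ball, Set.mem_ofPred_eq, Nat.cast_zero, nonpos_iff_eq_zero, SimpleGraph.edist_eq_zero_iff,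
    Set.mem_singleton_iff, eq_comm]

theorem mem_ball_iff {r : ℕ} {v w : V} :
    w ∈ ball G r v ↔ ∃ p : G.Walk v w, p.length ≤ r := by
  constructor
  · intro h
    have hne : G.edist v w ≠ ⊤ := fun h' => by
      simp only [ball, Set.mem_ofPred_eq, h'] at h
      exact absurd h (by simp)
    obtain ⟨p, hp⟩ := (SimpleGraph.edist_ne_top_iff_reachable.1 hne).exists_walk_length_eq_edist
    refine ⟨p, ?_⟩
    simp only [ball, Set.mem_ofPred_eq, ← hp] at h
    exact_mod_cast h
  · rintro ⟨p, hp⟩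
    exact (SimpleGraph.edist_le p).trans (by exact_mod_cast hp)

theorem mem_ball_succ_left {r : ℕ} {v w : V} :
    w ∈ ball G (r + 1) v ↔ v = w ∨ ∃ u, G.Adj v u ∧ w ∈ ball G r u := by
  constructor
  · intro h
    obtain ⟨p, hp⟩ := mem_ball_iff.1 h
    cases p with
    | nil => exact Or.inl rfl
    | cons h q =>
      refine Or.inr ⟨_, h, mem_ball_iff.2 ⟨q, ?_⟩⟩
      simpa using hp
  · rintro (rfl | ⟨u, hu, hw⟩)
    · exact mem_ball_self _ _
    · obtain ⟨p, hp⟩ := mem_ball_iff.1 hw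
      exact mem_ball_iff.2 ⟨SimpleGraph.Walk.cons hu p, by simpa using hp⟩

theorem mem_ball_succ_right {r : ℕ} {v w : V} :
    w ∈ ball G (r + 1) v ↔ w = v ∨ ∃ u, u ∈ ball G r v ∧ G.Adj u w := by
  rw [mem_ball_comm, mem_ball_succ_left]
  refine or_congr Iff.rfl (exists_congr fun u => ?_)
  rw [mem_ball_comm, SimpleGraph.adj_comm, and_comm]

theorem ball_mono {r s : ℕ} (h : r ≤ s) (v : V) : ball G r v ⊆ ball G s v := by
  intro w hw
  obtain ⟨p, hp⟩ := mem_ball_iff.1 hw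
  exact mem_ball_iff.2 ⟨p, hp.trans h⟩

theorem ball_trans {r s : ℕ} {u v w : V} (h : v ∈ ball G r u) (h' : w ∈ ball G s v) :
    w ∈ ball G (r + s) u := by
  obtain ⟨p, hp⟩ := mem_ball_iff.1 h
  obtain ⟨q, hq⟩ := mem_ball_iff.1 h'
  exact mem_ball_iff.2 ⟨p.append q, by rw [SimpleGraph.Walk.length_append]; omega⟩

theorem ncard_ball_le [Finite V] {d : ℕ} (hd : ∀ v, (G.neighborSet v).ncard ≤ d) (r : ℕ) (v : V) :
    (ball G r v).ncard ≤ (d + 1) ^ r := by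
  classical
  have := Fintype.ofFinite V
  induction r generalizing v with
  | zero => simp [ball_zero]
  | succ r ih =>
    have hsub : ball G (r + 1) v ⊆
        ⋃ u ∈ (insert v (G.neighborSet v)).toFinset, ball G r u := by
      intro w hw
      rcases mem_ball_succ_left.1 hw with rfl | ⟨u, hu, hw⟩
      · simp only [Set.mem_iUnion]
        exact ⟨_, by simp, mem_ball_self _ _⟩
      · simp only [Set.mem_iUnion]
        exact ⟨u, by simp [hu], hw⟩
    calc (ball G (r + 1) v).ncard
        ≤ (⋃ u ∈ (insert v (G.neighborSet v)).toFinset, ball G r u).ncard :=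
          Set.ncard_le_ncard hsub (Set.toFinite _)
      _ ≤ ∑ u ∈ (insert v (G.neighborSet v)).toFinset, (ball G r u).ncard :=
          Finset.set_ncard_biUnion_le _ _
      _ ≤ (insert v (G.neighborSet v)).toFinset.card * (d + 1) ^ r := by
          rw [← smul_eq_mul]
          exact Finset.sum_le_card_nsmul _ _ _ fun u _ => ih u
      _ ≤ (d + 1) * (d + 1) ^ r := by
          gcongr
          rw [← Set.ncard_eq_toFinset_card']
          exact (Set.ncard_insert_le _ _).trans (Nat.add_le_add_right (hd v) 1)
      _ = (d + 1) ^ (r + 1) := by ring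

/-- Two graphs which agree away from `W` have the same `r`-neighbourhood at any vertex whose
`r`-balls avoid `W`. -/
theorem ball_subset_of_agree {G' : SimpleGraph V} {W : Set V}
    (h : ∀ u v, u ∉ W → v ∉ W → (G.Adj u v ↔ G'.Adj u v)) {r : ℕ} {v : V}
    (hv : ∀ w ∈ ball G r v, w ∉ W) : ball G r v ⊆ ball G' r v := by
  induction r with
  | zero => simp [ball_zero]
  | succ r ih =>
    intro w hw
    have ih' := ih fun w hw => hv w (ball_mono (Nat.le_succ r) v hw)
    rcases mem_ball_succ_right.1 hw with rfl | ⟨u, hu, huw⟩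
    · exact mem_ball_self _ _
    · exact mem_ball_succ_right.2 (Or.inr ⟨u, ih' hu,
        (h u w (hv u (ball_mono (Nat.le_succ r) v hu)) (hv w hw)).1 huw⟩)

theorem neighborhoodClass_congr {G' : SimpleGraph V} {r k : ℕ} {f f' : V → Fin k} {v : V}
    (hb : ball G r v = ball G' r v)
    (hadj : ∀ u ∈ ball G r v, ∀ w ∈ ball G r v, (G.Adj u w ↔ G'.Adj u w))
    (hf : ∀ u ∈ ball G r v, f u = f' u) :
    neighborhoodClass G r f v = neighborhoodClass G' r f' v := by
  refine Quotient.sound ⟨⟨Equiv.setCongr hb, ?_⟩, ?_, ?_⟩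
  · rintro ⟨a, ha⟩ ⟨b, hb⟩
    exact (hadj a ha b hb).symm
  · rfl
  · rintro ⟨a, ha⟩
    exact (hf a ha).symm

theorem neighborhoodClass_eq_of_agree {G' : SimpleGraph V} {W : Set V}
    (h : ∀ u v, u ∉ W → v ∉ W → (G.Adj u v ↔ G'.Adj u v)) {r k : ℕ} (f : V → Fin k) {v : V}
    (hv : ∀ w ∈ ball G r v, w ∉ W) (hv' : ∀ w ∈ ball G' r v, w ∉ W) :
    neighborhoodClass G r f v = neighborhoodClass G' r f v :=
  neighborhoodClass_congr ((ball_subset_of_agree h hv).antisymm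
    (ball_subset_of_agree (fun u v hu hv => (h u v hu hv).symm) hv'))
    (fun u hu w hw => h u w (hv u hu) (hv w hw)) fun _ _ => rfl

end Balls

/-! ### Stability of local statistics under small perturbations -/

theorem dist_statistic_le {k : ℕ} {p q : Statistic k} {c : ℝ} (hc : 0 ≤ c)
    (h : ∀ A : Set (RootedClass k),
      |((UniformFun.toFun p A : unitInterval) : ℝ) - ((UniformFun.toFun q A : unitInterval) : ℝ)|
        ≤ c) : dist p q ≤ c := by
  rw [dist_statistic]
  exact Real.iSup_le h hc

/-- Only monotonicity and subadditivity enter, so none of the sets has to be measurable. -/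
theorem abs_measureReal_sub_le {V : Type*} [MeasurableSpace V] (ν : Measure V) [IsFiniteMeasure ν]
    {s t B : Set V} (h : ∀ v, v ∉ B → (v ∈ s ↔ v ∈ t)) : |ν.real s - ν.real t| ≤ ν.real B := by
  have key : ∀ {s t : Set V}, (∀ v, v ∉ B → (v ∈ s ↔ v ∈ t)) → ν.real s ≤ ν.real t + ν.real B := by
    intro s t h
    refine (measureReal_mono (s₂ := t ∪ B) fun v hv => ?_).trans (measureReal_union_le _ _)
    by_cases hB : v ∈ B
    · exact Or.inr hB
    · exact Or.inl ((h v hB).1 hv)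
  rw [abs_le]
  constructor <;> linarith [key h, key fun v hv => (h v hv).symm]

theorem dist_localStatistic_le {V : Type} [MeasurableSpace V] (ν : Measure V)
    [IsProbabilityMeasure ν] (G G' : SimpleGraph V) (r : ℕ) {k : ℕ} (f f' : V → Fin k) :
    dist (localStatistic ν G r f) (localStatistic ν G' r f') ≤
      ν.real {v | neighborhoodClass G r f v ≠ neighborhoodClass G' r f' v} := by
  refine dist_statistic_le measureReal_nonneg fun A => ?_
  refine abs_measureReal_sub_le ν fun v hv => ?_
  simp only [Set.mem_ofPred_eq, ne_eq, not_not] at hv ⊢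
  rw [hv]

theorem uniformOn_univ_real {V : Type*} [Fintype V] [Nonempty V] [MeasurableSpace V]
    [MeasurableSingletonClass V] (s : Set V) :
    (uniformOn (Set.univ : Set V)).real s = s.ncard / Fintype.card V := by
  classical
  have := Fintype.ofFinite s
  rw [measureReal_def, uniformOn_univ, ENNReal.toReal_div, Measure.count_apply_finite _ s.toFinite]
  rw [ENNReal.toReal_natCast, Set.ncard_eq_toFinset_card s s.toFinite]
  simp

namespace BoundedDegreeGraph

variable {d : ℕ}

theorem ncard_neighborSet_le (G : BoundedDegreeGraph d) (v : Fin G.card) :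
    (G.graph.neighborSet v).ncard ≤ d := by
  classical
  have := G.degree_le v
  rw [← Nat.card_coe_set_eq]
  rw [← SimpleGraph.card_neighborSet_eq_degree, ← Nat.card_eq_fintype_card] at this
  exact this

theorem ncard_ball_le (G : BoundedDegreeGraph d) (r : ℕ) (v : Fin G.card) :
    (ball G.graph r v).ncard ≤ (d + 1) ^ r :=
  LocalGlobal.ncard_ball_le G.ncard_neighborSet_le r v

end BoundedDegreeGraph

/-- The same colouring is used on both graphs. Its statistics differ only at vertices within
distance r of W in one of them, and each graph has at most |W|(d+1)^r of these. -/
theorem hausdorffDist_statisticSet_le {V : Type} [Fintype V] [Nonempty V] [MeasurableSpace V]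
    [MeasurableSingletonClass V] {d : ℕ} {G G' : SimpleGraph V}
    (hG : ∀ v, (G.neighborSet v).ncard ≤ d) (hG' : ∀ v, (G'.neighborSet v).ncard ≤ d)
    {W : Set V} (h : ∀ u v, u ∉ W → v ∉ W → (G.Adj u v ↔ G'.Adj u v)) (r k : ℕ) :
    Metric.hausdorffDist (statisticSet (uniformOn (Set.univ : Set V)) G r k)
      (statisticSet (uniformOn (Set.univ : Set V)) G' r k) ≤
      2 * W.ncard * (d + 1) ^ r / Fintype.card V := by
  classical
  have hbad : ∀ H : SimpleGraph V, (∀ v, (H.neighborSet v).ncard ≤ d) →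
      {v | ∃ w ∈ ball H r v, w ∈ W}.ncard ≤ W.ncard * (d + 1) ^ r := by
    intro H hH
    have hsub : {v | ∃ w ∈ ball H r v, w ∈ W} ⊆ ⋃ w ∈ W.toFinset, ball H r w := by
      rintro v ⟨w, hw, hW⟩
      simp only [Set.mem_iUnion]
      exact ⟨w, by simpa using hW, mem_ball_comm.1 hw⟩
    refine (Set.ncard_le_ncard hsub (Set.toFinite _)).trans
      ((Finset.set_ncard_biUnion_le _ _).trans ?_)
    rw [Set.ncard_eq_toFinset_card' W, ← smul_eq_mul]
    exact Finset.sum_le_card_nsmul _ _ _ fun u _ => ncard_ball_le hH r u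
  have key : ∀ f : V → Fin k, dist (localStatistic (uniformOn (Set.univ : Set V)) G r f)
      (localStatistic (uniformOn (Set.univ : Set V)) G' r f) ≤
      2 * W.ncard * (d + 1) ^ r / Fintype.card V := by
    intro f
    refine (dist_localStatistic_le _ _ _ _ _ _).trans ?_
    rw [uniformOn_univ_real]
    gcongr
    have hsub : {v | neighborhoodClass G r f v ≠ neighborhoodClass G' r f v} ⊆
        {v | ∃ w ∈ ball G r v, w ∈ W} ∪ {v | ∃ w ∈ ball G' r v, w ∈ W} := by
      intro v hv
      by_contra hcon
      simp only [Set.mem_union, Set.mem_ofPred_eq, not_or, not_exists, not_and] at hcon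
      exact hv (neighborhoodClass_eq_of_agree h f hcon.1 hcon.2)
    have h1 := (Set.ncard_le_ncard hsub (Set.toFinite _)).trans (Set.ncard_union_le _ _)
    have h2 : {v | neighborhoodClass G r f v ≠ neighborhoodClass G' r f v}.ncard ≤
        2 * W.ncard * (d + 1) ^ r := by linarith [hbad G hG, hbad G' hG']
    exact_mod_cast h2
  refine Metric.hausdorffDist_le_of_mem_dist (by positivity) ?_ ?_
  · rintro _ ⟨f, hf, rfl⟩
    exact ⟨_, ⟨f, hf, rfl⟩, key f⟩
  · rintro _ ⟨f, hf, rfl⟩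
    exact ⟨_, ⟨f, hf, rfl⟩, by rw [dist_comm]; exact key f⟩

/-! ### Compactness of the completion -/

instance (d : ℕ) : Nonempty (BoundedDegreeGraph d) :=
  ⟨{ card := 1, card_pos := one_pos, graph := ⊥, degree_le := fun v => by simp }⟩

/-- The isomorphism classes of coloured `r`-balls in graphs with degrees at most `d`. -/
def ballClasses (d r k : ℕ) : Set (RootedClass k) :=
  {c | ∃ (G : BoundedDegreeGraph d) (f : Fin G.card → Fin k) (v : Fin G.card),
    c = neighborhoodClass G.graph r f v}

/-- A ball has at most (d+1)^r vertices, so its class is realised on some `Fin m` with m bounded. -/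
theorem finite_ballClasses (d r k : ℕ) : (ballClasses d r k).Finite := by
  classical
  let Ψ : (Σ m : Fin ((d + 1) ^ r + 1), SimpleGraph (Fin m) × Fin m × (Fin m → Fin k)) →
      RootedClass k := fun x => Quotient.mk _
        { V := Fin x.1, graph := x.2.1, root := x.2.2.1, color := x.2.2.2 }
  refine (Set.finite_range Ψ).subset ?_
  rintro _ ⟨G, f, v, rfl⟩
  let B := ball G.graph r v
  have e : B ≃ Fin (Nat.card B) := Finite.equivFin B
  have hcard : Nat.card B < (d + 1) ^ r + 1 := by
    rw [Nat.card_coe_set_eq]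
    exact Nat.lt_succ_of_le (G.ncard_ball_le r v)
  refine ⟨⟨⟨Nat.card B, hcard⟩, (G.graph.induce B).map e.toEmbedding, e ⟨v, mem_ball_self r v⟩,
    fun i => f (e.symm i)⟩, ?_⟩
  refine Quotient.sound (Setoid.symm ⟨SimpleGraph.Iso.map e (G.graph.induce B), rfl, fun w => ?_⟩)
  change f (e.symm (e w)) = f w
  rw [e.symm_apply_apply]

/-- The statistics which only depend on the trace of an event on the finite set `𝒞`. -/
def supportedStatistics {k : ℕ} (𝒞 : Set (RootedClass k)) : Set (Statistic k) :=
  Set.range fun g : Set 𝒞 → unitInterval =>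
    (UniformFun.ofFun fun A => g (Subtype.val ⁻¹' A) : Statistic k)

/-- The set is a 1-Lipschitz image of a finite-dimensional cube. Additivity is not imposed on its
members: any compact set containing the statistics will do. -/
theorem isCompact_supportedStatistics {k : ℕ} {𝒞 : Set (RootedClass k)} (h : 𝒞.Finite) :
    IsCompact (supportedStatistics 𝒞) := by
  have := h.to_subtype
  have := Fintype.ofFinite (Set 𝒞)
  refine isCompact_range (LipschitzWith.of_dist_le_mul (K := 1) fun g g' => ?_).continuous
  rw [NNReal.coe_one, one_mul]
  exact dist_statistic_le dist_nonneg fun A => dist_le_pi_dist g g' (Subtype.val ⁻¹' A)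

theorem localStatistic_mem_supportedStatistics {V : Type} [MeasurableSpace V] (ν : Measure V)
    [IsProbabilityMeasure ν] (G : SimpleGraph V) (r : ℕ) {k : ℕ} (f : V → Fin k)
    {𝒞 : Set (RootedClass k)} (h : ∀ v, neighborhoodClass G r f v ∈ 𝒞) :
    localStatistic ν G r f ∈ supportedStatistics 𝒞 := by
  refine ⟨fun B => UniformFun.toFun (localStatistic ν G r f) (Subtype.val '' B), ?_⟩
  refine congrArg UniformFun.ofFun (funext fun A => Subtype.ext ?_)
  change ν.real _ = ν.real _
  congr 1
  ext v
  simp [h v]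

namespace BoundedDegreeGraph

variable {d : ℕ}

theorem Q_subset (G : BoundedDegreeGraph d) (r k : ℕ) :
    G.Q r k ⊆ supportedStatistics (ballClasses d r k) := by
  rintro _ ⟨f, -, rfl⟩
  exact localStatistic_mem_supportedStatistics _ _ _ _ fun v => ⟨G, f, v, rfl⟩

/-- One net serves all graphs, because all the sets `G.Q r k` lie in one compact set. Its points
need not be statistics of graphs. -/
theorem exists_finite_net (d r k : ℕ) {ε : ℝ} (hε : 0 < ε) :
    ∃ t : Finset (Statistic k), ∀ G : BoundedDegreeGraph d, ∀ p ∈ G.Q r k, ∃ q ∈ t,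
      dist p q < ε := by
  obtain ⟨t, ht, hcov⟩ := Metric.totallyBounded_iff.1
    (isCompact_supportedStatistics (finite_ballClasses d r k)).totallyBounded ε hε
  refine ⟨ht.toFinset, fun G p hp => ?_⟩
  have := hcov (G.Q_subset r k hp)
  simp only [Set.mem_iUnion, Metric.mem_ball] at this
  obtain ⟨q, hq, hpq⟩ := this
  exact ⟨q, by simpa using hq, hpq⟩

/-- If the distances to the points of an `ε`-net are close, then so are the sets of statistics. -/
theorem hausdorffDist_Q_le {r k : ℕ} {ε : ℝ} (hε : 0 ≤ ε) {t : Finset (Statistic (k + 1))}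
    (ht : ∀ G : BoundedDegreeGraph d, ∀ p ∈ G.Q r (k + 1), ∃ q ∈ t, dist p q < ε)
    {G G' : BoundedDegreeGraph d}
    (h : ∀ q ∈ t, |Metric.infDist q (G.Q r (k + 1)) - Metric.infDist q (G'.Q r (k + 1))| < ε) :
    Metric.hausdorffDist (G.Q r (k + 1)) (G'.Q r (k + 1)) ≤ 3 * ε := by
  have key : ∀ {G G' : BoundedDegreeGraph d}, (∀ q ∈ t,
      |Metric.infDist q (G.Q r (k + 1)) - Metric.infDist q (G'.Q r (k + 1))| < ε) →
      ∀ p ∈ G.Q r (k + 1), ∃ p' ∈ G'.Q r (k + 1), dist p p' ≤ 3 * ε := by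
    intro G G' h p hp
    obtain ⟨q, hq, hpq⟩ := ht G p hp
    have h1 : Metric.infDist q (G.Q r (k + 1)) < ε :=
      (Metric.infDist_le_dist_of_mem hp).trans_lt (by rwa [dist_comm])
    -- The net point q is within ε of `G.Q`, hence within 2ε of `G'.Q`; the detour from p through q
    -- costs 3ε.
    have h2 : Metric.infDist q (G'.Q r (k + 1)) < 2 * ε := by
      linarith [(abs_lt.1 (h q hq)).1]
    obtain ⟨p', hp', h3⟩ := (Metric.infDist_lt_iff (G'.Q_nonempty r k)).1 h2
    exact ⟨p', hp', by linarith [dist_triangle p q p']⟩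
  refine Metric.hausdorffDist_le_of_mem_dist (by positivity) (key h) (key fun q hq => ?_)
  rw [abs_sub_comm]
  exact h q hq

theorem hausdorffDist_le_dist (G G' : BoundedDegreeGraph d) (r k : ℕ) :
    Metric.hausdorffDist (G.Q (r + 1) (k + 1)) (G'.Q (r + 1) (k + 1)) ≤
      2 ^ ((k + 1) + (r + 1)) * dist G G' := by
  have h1 := (summable_inner G G' k).le_tsum r fun j _ => term_nonneg G G' k j
  have h2 := (summable_outer G G').le_tsum k fun j _ => tsum_nonneg (term_nonneg G G' j)
  have h3 : (1 / 2 : ℝ) ^ ((k + 1) + (r + 1)) *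
      Metric.hausdorffDist (G.Q (r + 1) (k + 1)) (G'.Q (r + 1) (k + 1)) ≤ dist G G' := h1.trans h2
  calc _ = 2 ^ ((k + 1) + (r + 1)) * ((1 / 2 : ℝ) ^ ((k + 1) + (r + 1)) *
      Metric.hausdorffDist (G.Q (r + 1) (k + 1)) (G'.Q (r + 1) (k + 1))) := by
        rw [← mul_assoc, ← mul_pow]; norm_num
    _ ≤ _ := by gcongr

theorem tsum_geom_tail (K : ℕ) : ∑' k : ℕ, (if k < K then 0 else (1 / 2 : ℝ) ^ (k + 1)) =
    (1 / 2) ^ K := by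
  have hs : Summable fun k : ℕ => (if k < K then 0 else (1 / 2 : ℝ) ^ (k + 1)) :=
    Summable.of_nonneg_of_le (fun k => by positivity)
      (fun k => by split_ifs <;> first | positivity | exact le_rfl) summable_geom
  rw [← hs.sum_add_tsum_nat_add K, Finset.sum_eq_zero, zero_add]
  · have : ∀ i : ℕ, (if i + K < K then 0 else (1 / 2 : ℝ) ^ (i + K + 1)) =
        (1 / 2) ^ K * ((1 / 2) * (1 / 2) ^ i) := by
      intro i
      rw [if_neg (by omega)]
      ring
    simp_rw [this, tsum_mul_left, tsum_geometric_two]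
    norm_num
  · intro i hi
    rw [if_pos (Finset.mem_range.1 hi)]

theorem tsum_geom : ∑' k : ℕ, (1 / 2 : ℝ) ^ (k + 1) = 1 := by
  simpa using tsum_geom_tail 0

/-- The distance is controlled by finitely many of the Hausdorff distances. -/
theorem dist_le_of_hausdorffDist_le {K : ℕ} {ε : ℝ} {G G' : BoundedDegreeGraph d} (hε : 0 ≤ ε)
    (h : ∀ r < K, ∀ k < K, Metric.hausdorffDist (G.Q (r + 1) (k + 1)) (G'.Q (r + 1) (k + 1)) ≤ ε) :
    dist G G' ≤ ε + 2 * (1 / 2) ^ K := by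
  -- The majorant has a head ε a_k a_r, for both indices below K, and two tails b_k a_r and a_k b_r,
  -- each of total mass (1/2)^K.
  let a : ℕ → ℝ := fun k => (1 / 2 : ℝ) ^ (k + 1)
  let b : ℕ → ℝ := fun k => if k < K then 0 else (1 / 2 : ℝ) ^ (k + 1)
  have ha0 : ∀ k, 0 ≤ a k := fun k => by positivity
  have hb0 : ∀ k, 0 ≤ b k := fun k => by positivity
  have hba : ∀ k, b k ≤ a k := fun k => by
    simp only [a, b]; split_ifs <;> first | positivity | exact le_rfl
  have hsa : Summable a := summable_geom
  have hsb : Summable b := Summable.of_nonneg_of_le hb0 hba hsa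
  have hta : ∑' k, a k = 1 := tsum_geom
  have htb : ∑' k, b k = (1 / 2) ^ K := tsum_geom_tail K
  have hterm : ∀ k r, (1 / 2 : ℝ) ^ ((k + 1) + (r + 1)) *
      Metric.hausdorffDist (G.Q (r + 1) (k + 1)) (G'.Q (r + 1) (k + 1)) ≤
      ε * a k * a r + b k * a r + a k * b r := by
    intro k r
    have hH := hausdorffDist_le_one G G' (r + 1) k
    have hp : (1 / 2 : ℝ) ^ ((k + 1) + (r + 1)) = a k * a r := pow_add _ _ _
    rw [hp]
    have hpos : 0 ≤ a k * a r := mul_nonneg (ha0 k) (ha0 r)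
    by_cases hk : k < K
    · by_cases hr : r < K
      · nlinarith [h r hr k hk, mul_le_mul_of_nonneg_left (h r hr k hk) hpos,
          mul_nonneg (hb0 k) (ha0 r), mul_nonneg (ha0 k) (hb0 r)]
      · have : b r = a r := if_neg hr
        rw [this]
        nlinarith [mul_le_mul_of_nonneg_left hH hpos, mul_nonneg (hb0 k) (ha0 r),
          mul_nonneg hε hpos]
    · have : b k = a k := if_neg hk
      rw [this]
      nlinarith [mul_le_mul_of_nonneg_left hH hpos, mul_nonneg (ha0 k) (hb0 r),
          mul_nonneg hε hpos]
  have hinner : ∀ k, ∑' r, (1 / 2 : ℝ) ^ ((k + 1) + (r + 1)) *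
      Metric.hausdorffDist (G.Q (r + 1) (k + 1)) (G'.Q (r + 1) (k + 1)) ≤
      ε * a k + b k + a k * (1 / 2) ^ K := by
    intro k
    have h1 : HasSum (fun r => ε * a k * a r + b k * a r + a k * b r)
        (ε * a k * 1 + b k * 1 + a k * (1 / 2) ^ K) := by
      have hb' : HasSum b ((1 / 2) ^ K) := htb ▸ hsb.hasSum
      have ha' : HasSum a 1 := hta ▸ hsa.hasSum
      exact ((ha'.mul_left _).add (ha'.mul_left _)).add (hb'.mul_left _)
    have := (summable_inner G G' k).tsum_le_tsum (hterm k) h1.summable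
    rwa [h1.tsum_eq, mul_one, mul_one] at this
  have h2 : HasSum (fun k => ε * a k + b k + a k * (1 / 2) ^ K)
      (ε * 1 + (1 / 2) ^ K + 1 * (1 / 2) ^ K) := by
    have hb' : HasSum b ((1 / 2) ^ K) := htb ▸ hsb.hasSum
    have ha' : HasSum a 1 := hta ▸ hsa.hasSum
    exact ((ha'.mul_left _).add hb').add (ha'.mul_right _)
  have := (summable_outer G G').tsum_le_tsum hinner h2.summable
  rw [h2.tsum_eq] at this
  calc dist G G' ≤ _ := this
    _ = _ := by ring

/-- Finitely many functions `G ↦ infDist q (Q_{r, G, k})` control the distance. -/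
theorem exists_controlling_net (d : ℕ) {δ : ℝ} (hδ : 0 < δ) :
    ∃ (K : ℕ) (t : ∀ _ k : ℕ, Finset (Statistic (k + 1))) (η : ℝ), 0 < η ∧
      ∀ G G' : BoundedDegreeGraph d, (∀ r < K, ∀ k < K, ∀ q ∈ t r k,
        |Metric.infDist q (G.Q (r + 1) (k + 1)) - Metric.infDist q (G'.Q (r + 1) (k + 1))| < η) →
        dist G G' ≤ δ := by
  -- The tail gets 2(1/2)^K < δ/2 and the head 3 · δ/6 = δ/2.
  obtain ⟨K, hK⟩ := exists_pow_lt_of_lt_one (show 0 < δ / 4 by positivity)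
    (show (1 / 2 : ℝ) < 1 by norm_num)
  choose t ht using fun r k : ℕ => exists_finite_net d (r + 1) (k + 1) (show 0 < δ / 6 by positivity)
  refine ⟨K, t, δ / 6, by positivity, fun G G' h => ?_⟩
  have := dist_le_of_hausdorffDist_le (K := K) (ε := δ / 2) (G := G) (G' := G') (by positivity)
    fun r hr k hk => (hausdorffDist_Q_le (by positivity) (ht r k) (h r hr k hk)).trans
      (by linarith)
  linarith

/-- The finitely many control functions map X_d into a cube, and graphs with nearby images are
close. -/
theorem totallyBounded_univ (d : ℕ) : TotallyBounded (Set.univ : Set (BoundedDegreeGraph d)) := by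
  refine Metric.totallyBounded_iff.2 fun δ hδ => ?_
  obtain ⟨K, t, η, hη, h⟩ := exists_controlling_net d (half_pos hδ)
  let I := Σ (r : Fin K) (k : Fin K), t r k
  let F : BoundedDegreeGraph d → I → ℝ := fun G i =>
    Metric.infDist (i.2.2 : Statistic (i.2.1 + 1)) (G.Q (i.1 + 1) (i.2.1 + 1))
  have hF : TotallyBounded (Set.range F) := by
    refine (isCompact_univ_pi fun _ : I => isCompact_Icc (a := (0 : ℝ)) (b := 1)).totallyBounded.subset
      ?_
    rintro _ ⟨G, rfl⟩ i -
    refine ⟨Metric.infDist_nonneg, ?_⟩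
    obtain ⟨p, hp⟩ := G.Q_nonempty (i.1 + 1) i.2.1
    exact (Metric.infDist_le_dist_of_mem hp).trans (dist_statistic_le_one _ _)
  obtain ⟨s, hs, hfin, hcov⟩ := Metric.finite_approx_of_totallyBounded hF η hη
  choose! g hg using fun y (hy : y ∈ s) => hs hy
  refine ⟨g '' s, hfin.image g, fun G _ => ?_⟩
  have := hcov ⟨G, rfl⟩
  simp only [Set.mem_iUnion, Metric.mem_ball] at this
  obtain ⟨y, hy, hGy⟩ := this
  simp only [Set.mem_iUnion, Metric.mem_ball]
  refine ⟨g y, ⟨y, hy, rfl⟩, (h G (g y) fun r hr k hk q hq => ?_).trans_lt (by linarith)⟩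
  have := (dist_le_pi_dist (F G) y ⟨⟨r, hr⟩, ⟨k, hk⟩, ⟨q, hq⟩⟩).trans_lt hGy
  rw [← hg y hy] at this
  exact this

end BoundedDegreeGraph

instance (d : ℕ) : CompactSpace (LimitSpace d) := by
  constructor
  have h1 : TotallyBounded (Set.range ((↑) : BoundedDegreeGraph d → LimitSpace d)) := by
    rw [← Set.image_univ]
    exact (BoundedDegreeGraph.totallyBounded_univ d).image
      (UniformSpace.Completion.uniformContinuous_coe _)
  have h2 := h1.closure
  rw [UniformSpace.Completion.denseRange_coe.closure_range] at h2
  exact h2.isCompact_of_isClosed isClosed_univ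

/-! ### Neighbourhoods read off from labels along words -/

section Words

variable {C V V' S : Type*}

/-- The action of a word on a set on which the letters act; the first letter acts first. -/
def word (τ : C → V → V) (w : List C) (v : V) : V := w.foldl (fun v c => τ c v) v

@[simp] theorem word_nil (τ : C → V → V) (v : V) : word τ [] v = v := rfl

@[simp] theorem word_cons (τ : C → V → V) (c : C) (w : List C) (v : V) :
    word τ (c :: w) v = word τ w (τ c v) := rfl

theorem word_append (τ : C → V → V) (w w' : List C) (v : V) :
    word τ (w ++ w') v = word τ w' (word τ w v) := List.foldl_append

/-- The edges of the graph are the nontrivial orbits of the maps `τ c`. -/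
def Generates (τ : C → V → V) (G : SimpleGraph V) : Prop :=
  ∀ u v, G.Adj u v ↔ u ≠ v ∧ ∃ c, τ c u = v

/-- The labelling `s` distinguishes vertices reached from the same vertex by words of length at
most `R`. -/
def Separates (τ : C → V → V) (s : V → S) (R : ℕ) : Prop :=
  ∀ v w w', w.length ≤ R → w'.length ≤ R → s (word τ w v) = s (word τ w' v) →
    word τ w v = word τ w' v

end Words

theorem Generates.mem_ball_iff {C : Type*} {V : Type} {τ : C → V → V} {G : SimpleGraph V}
    (h : Generates τ G) {r : ℕ} {u v : V} :
    u ∈ ball G r v ↔ ∃ w : List C, w.length ≤ r ∧ word τ w v = u := by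
  constructor
  · induction r generalizing v with
    | zero =>
      rw [ball_zero]
      rintro rfl
      exact ⟨[], le_rfl, rfl⟩
    | succ r ih =>
      intro hu
      rcases mem_ball_succ_left.1 hu with rfl | ⟨x, hx, hu⟩
      · exact ⟨[], Nat.zero_le _, rfl⟩
      · obtain ⟨-, c, rfl⟩ := (h _ _).1 hx
        obtain ⟨w, hw, rfl⟩ := ih hu
        exact ⟨c :: w, by simpa using hw, rfl⟩
  · rintro ⟨w, hw, rfl⟩
    induction w generalizing r v with
    | nil => exact mem_ball_self _ _
    | cons c w ih =>
      obtain ⟨r, rfl⟩ : ∃ r', r = r' + 1 := ⟨r - 1, by simp at hw; omega⟩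
      have h1 := ih (r := r) (v := τ c v) (by simpa using hw)
      rw [word_cons]
      -- A letter fixing the vertex is not an edge: the walk pauses, and the bound on its length
      -- still holds.
      by_cases hc : v = τ c v
      · rw [← hc] at h1 ⊢
        exact ball_mono (Nat.le_succ r) v h1
      · exact mem_ball_succ_left.2 (Or.inr ⟨_, (h _ _).2 ⟨hc, c, rfl⟩, h1⟩)

/-- Vertices of two separated systems with the same labels on words of length at most `r + 1` have
isomorphic coloured `r`-neighbourhoods. -/
theorem neighborhoodClass_eq_of_pattern {C S : Type*} {V V' : Type} {τ : C → V → V}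
    {τ' : C → V' → V'} {G : SimpleGraph V} {G' : SimpleGraph V'} (hG : Generates τ G)
    (hG' : Generates τ' G') {s : V → S} {s' : V' → S} {r k : ℕ} (hs : Separates τ s (r + 1))
    (hs' : Separates τ' s' (r + 1)) {f : V → Fin k} {f' : V' → Fin k} {v : V} {v' : V'}
    (h : ∀ w : List C, w.length ≤ r + 1 → s (word τ w v) = s' (word τ' w v'))
    (hf : ∀ w : List C, w.length ≤ r → f (word τ w v) = f' (word τ' w v')) :
    neighborhoodClass G r f v = neighborhoodClass G' r f' v' := by
  -- The labels decide which words end at the same vertex, so both balls are the same quotient of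
  -- the set of words of length at most r.
  have key : ∀ w w' : List C, w.length ≤ r + 1 → w'.length ≤ r + 1 →
      (word τ w v = word τ w' v ↔ word τ' w v' = word τ' w' v') := by
    intro w w' hw hw'
    constructor
    · intro heq
      refine hs' v' w w' hw hw' ?_
      rw [← h w hw, ← h w' hw', heq]
    · intro heq
      refine hs v w w' hw hw' ?_
      rw [h w hw, h w' hw', heq]
  have hex : ∀ u : ball G r v, ∃ w : List C, w.length ≤ r ∧ word τ w v = u :=
    fun u => hG.mem_ball_iff.1 u.2
  choose W hW hWu using hex
  let e : ball G r v → ball G' r v' := fun u =>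
    ⟨word τ' (W u) v', hG'.mem_ball_iff.2 ⟨W u, hW u, rfl⟩⟩
  have hinj : Function.Injective e := by
    intro a b hab
    have := congrArg Subtype.val hab
    refine Subtype.ext ?_
    rw [← hWu a, ← hWu b]
    exact (key _ _ (by have := hW a; omega) (by have := hW b; omega)).2 this
  have hword : ∀ (w : List C) (hw : w.length ≤ r),
      e ⟨word τ w v, hG.mem_ball_iff.2 ⟨w, hw, rfl⟩⟩ =
        ⟨word τ' w v', hG'.mem_ball_iff.2 ⟨w, hw, rfl⟩⟩ := by
    intro w hw
    refine Subtype.ext ((key _ _ ?_ (by omega)).1 (hWu _))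
    exact (hW _).trans (Nat.le_succ r)
  have hsurj : Function.Surjective e := by
    rintro ⟨u, hu⟩
    obtain ⟨w, hw, rfl⟩ := hG'.mem_ball_iff.1 hu
    exact ⟨_, hword w hw⟩
  refine Quotient.sound ⟨⟨Equiv.ofBijective e ⟨hinj, hsurj⟩, ?_⟩, ?_, ?_⟩
  · intro a b
    obtain ⟨a, ha⟩ := a
    obtain ⟨b, hb⟩ := b
    obtain ⟨w, hw, rfl⟩ := hG.mem_ball_iff.1 ha
    obtain ⟨w', hw', rfl⟩ := hG.mem_ball_iff.1 hb
    change G'.Adj (e _ : V') (e _ : V') ↔ G.Adj _ _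
    rw [hword w hw, hword w' hw', hG, hG']
    refine and_congr (not_congr (key w w' (by omega) (by omega)).symm) (exists_congr fun c => ?_)
    -- Adjacency compares a word of length r + 1 with one of length r; this is why separation is
    -- required at radius r + 1.
    have := key (w ++ [c]) w' (by simpa using hw) (by omega)
    simpa [word_append] using this.symm
  · exact hword [] (Nat.zero_le r)
  · rintro ⟨u, hu⟩
    obtain ⟨w, hw, rfl⟩ := hG.mem_ball_iff.1 hu
    change f' (e _ : V') = f _
    rw [hword w hw]
    exact (hf w hw).symm

/-! ### Distance colourings, nets of colourings and edge matchings -/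

theorem exists_greedy_coloring {V : Type*} [Finite V] (H : SimpleGraph V) {N : ℕ}
    (hN : ∀ v, (H.neighborSet v).ncard ≤ N) :
    ∃ s : V → Fin (N + 1), ∀ u v, H.Adj u v → s u ≠ s v := by
  classical
  have := Fintype.ofFinite V
  suffices h : ∀ t : Finset V, ∃ s : V → Fin (N + 1), ∀ u ∈ t, ∀ v ∈ t, H.Adj u v → s u ≠ s v by
    obtain ⟨s, hs⟩ := h Finset.univ
    exact ⟨s, fun u v => hs u (Finset.mem_univ u) v (Finset.mem_univ v)⟩
  intro t
  induction t using Finset.induction_on with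
  | empty => exact ⟨fun _ => 0, by simp⟩
  | insert a t ha ih =>
    obtain ⟨s, hs⟩ := ih
    have hlt : (s '' H.neighborSet a).ncard < (Set.univ : Set (Fin (N + 1))).ncard := by
      rw [Set.ncard_univ, Nat.card_fin]
      exact Nat.lt_succ_of_le ((Set.ncard_image_le (Set.toFinite _)).trans (hN a))
    obtain ⟨c, -, hc⟩ := Set.exists_mem_notMem_of_ncard_lt_ncard hlt (Set.toFinite _)
    have hc' : ∀ v, H.Adj a v → s v ≠ c := fun v hv h => hc ⟨v, hv, h⟩
    refine ⟨Function.update s a c, fun u hu v hv huv => ?_⟩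
    rw [Finset.mem_insert] at hu hv
    rcases eq_or_ne u a with rfl | hua
    · rw [Function.update_self, Function.update_of_ne huv.ne']
      exact (hc' v huv).symm
    · rw [Function.update_of_ne hua]
      rcases eq_or_ne v a with rfl | hva
      · rw [Function.update_self]
        exact hc' u huv.symm
      · rw [Function.update_of_ne hva]
        exact hs u (hu.resolve_left hua) v (hv.resolve_left hva) huv

namespace BoundedDegreeGraph

variable {d : ℕ}

theorem exists_distance_coloring (G : BoundedDegreeGraph d) (R : ℕ) :
    ∃ s : Fin G.card → Fin ((d + 1) ^ R + 1), ∀ u, ∀ v ∈ ball G.graph R u, s u = s v → u = v := by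
  let H : SimpleGraph (Fin G.card) :=
    { Adj := fun u v => u ≠ v ∧ v ∈ ball G.graph R u
      symm := ⟨fun u v h => ⟨h.1.symm, mem_ball_comm.1 h.2⟩⟩
      loopless := ⟨fun u h => h.1 rfl⟩ }
  obtain ⟨s, hs⟩ := exists_greedy_coloring H (N := (d + 1) ^ R) fun v =>
    (Set.ncard_le_ncard (fun u hu => hu.2) (Set.toFinite _)).trans (G.ncard_ball_le R v)
  exact ⟨s, fun u v hv h => by_contra fun hne => hs u v ⟨hne, hv⟩ h⟩

/-- The number N does not depend on G, so the colourings of the net can be carried to the limit as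
labels with a fixed index set. -/
theorem exists_coloring_net (d r k : ℕ) {ε : ℝ} (hε : 0 < ε) :
    ∃ N : ℕ, ∀ G : BoundedDegreeGraph d, ∃ F : Fin N → Fin G.card → Fin (k + 1),
      ∀ f : Fin G.card → Fin (k + 1), ∃ a,
        dist (localStatistic (uniformOn Set.univ) G.graph r f)
          (localStatistic (uniformOn Set.univ) G.graph r (F a)) < ε := by
  obtain ⟨t, ht⟩ := exists_finite_net d r (k + 1) (half_pos hε)
  refine ⟨t.card, fun G => ?_⟩
  have : ∀ q : Statistic (k + 1), ∃ f' : Fin G.card → Fin (k + 1),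
      ∀ f : Fin G.card → Fin (k + 1),
        dist (localStatistic (uniformOn Set.univ) G.graph r f) q < ε / 2 →
        dist (localStatistic (uniformOn Set.univ) G.graph r f') q < ε / 2 := by
    intro q
    by_cases h : ∃ f : Fin G.card → Fin (k + 1),
      dist (localStatistic (uniformOn Set.univ) G.graph r f) q < ε / 2
    · obtain ⟨f, hf⟩ := h
      exact ⟨f, fun _ _ => hf⟩
    · exact ⟨fun _ => 0, fun f hf => absurd ⟨f, hf⟩ h⟩
  choose F hF using this
  refine ⟨fun a => F (t.equivFin.symm a), fun f => ?_⟩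
  obtain ⟨q, hq, hfq⟩ := ht G _ ⟨f, Measurable.of_discrete, rfl⟩
  refine ⟨t.equivFin ⟨q, hq⟩, ?_⟩
  simp only [Equiv.symm_apply_apply]
  have := hF q f hfq
  linarith [dist_triangle_right (localStatistic (uniformOn Set.univ) G.graph r f)
    (localStatistic (uniformOn Set.univ) G.graph r (F q)) q]

end BoundedDegreeGraph

section Matchings

open Classical in
/-- The matching of a vertex-coloured graph formed by the edges whose pair of end colours is `e`,
as a map exchanging the two end vertices of each of these edges. -/
def matchingMap {V S : Type*} (G : SimpleGraph V) (s : V → S) (e : Sym2 S) (v : V) : V :=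
  if h : ∃ u, G.Adj v u ∧ s(s v, s u) = e then h.choose else v

variable {V : Type} {S : Type*} {G : SimpleGraph V} {s : V → S}
  (hs : ∀ u, ∀ v ∈ ball G 2 u, s u = s v → u = v)

include hs

/-- By `hs`, two neighbours of one vertex with the same label are equal. The label of the neighbour
is determined by e and the label of v, so the choice in `matchingMap` is forced. -/
theorem matchingMap_eq {e : Sym2 S} {u v : V} (h : G.Adj v u) (he : s(s v, s u) = e) :
    matchingMap G s e v = u := by
  have hex : ∃ u, G.Adj v u ∧ s(s v, s u) = e := ⟨u, h, he⟩
  rw [matchingMap, dif_pos hex]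
  obtain ⟨h1, h2⟩ := hex.choose_spec
  refine hs _ _ ?_ (Sym2.congr_right.1 (h2.trans he.symm))
  have hb : ∀ {x y : V}, G.Adj x y → y ∈ ball G 1 x := fun h =>
    mem_ball_succ_left.2 (Or.inr ⟨_, h, mem_ball_self _ _⟩)
  exact ball_trans (hb h1.symm) (hb h)

theorem matchingMap_involutive (e : Sym2 S) : Function.Involutive (matchingMap G s e) := by
  intro v
  by_cases h : ∃ u, G.Adj v u ∧ s(s v, s u) = e
  · obtain ⟨u, hu, he⟩ := h
    rw [matchingMap_eq hs hu he]
    exact matchingMap_eq hs hu.symm (by rw [Sym2.eq_swap, he])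
  · have : matchingMap G s e v = v := dif_neg h
    rw [this, this]

theorem matchingMap_of_ne {e : Sym2 S} {v : V} (h : matchingMap G s e v ≠ v) :
    G.Adj v (matchingMap G s e v) ∧ s(s v, s (matchingMap G s e v)) = e := by
  by_cases hex : ∃ u, G.Adj v u ∧ s(s v, s u) = e
  · obtain ⟨u, hu, he⟩ := hex
    rw [matchingMap_eq hs hu he]
    exact ⟨hu, he⟩
  · exact absurd (dif_neg hex) h

theorem generates_matchingMap : Generates (matchingMap G s) G := by
  intro u v
  constructor
  · intro h
    exact ⟨h.ne, s(s u, s v), matchingMap_eq hs h rfl⟩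
  · rintro ⟨hne, e, rfl⟩
    exact (matchingMap_of_ne hs hne.symm).1

theorem matchingMap_proper {e e' : Sym2 S} {v : V} (h : matchingMap G s e v = matchingMap G s e' v)
    (hv : matchingMap G s e v ≠ v) : e = e' := by
  have h1 := (matchingMap_of_ne hs hv).2
  have h2 := (matchingMap_of_ne hs (h ▸ hv : matchingMap G s e' v ≠ v)).2
  rw [← h1, h, h2]

end Matchings

/-- A decomposition of the edges of a finite graph into matchings, indexed by `C`, together with
labellings of its vertices, indexed by `J`, of which the labellings `sep R` are separating. -/
structure Decoration {d : ℕ} (G : BoundedDegreeGraph d) (C : Type) {J : Type} (κ : J → ℕ)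
    (sep : ℕ → J) where
  τ : C → Fin G.card → Fin G.card
  ℓ : ∀ j, Fin G.card → Fin (κ j)
  involutive : ∀ c, Function.Involutive (τ c)
  generates : Generates τ G.graph
  proper : ∀ {c c' v}, τ c v = τ c' v → τ c v ≠ v → c = c'
  separates : ∀ R, Separates τ (ℓ (sep R)) R

/-- Every finite graph can be decorated, with prescribed additional labellings. -/
theorem exists_decoration {d : ℕ} {J : Type} {κ : J → ℕ} (G : BoundedDegreeGraph d)
    (ℓ : ∀ j, Fin G.card → Fin (κ j)) :
    ∃ D : Decoration G (Sym2 (Fin ((d + 1) ^ 2 + 1)))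
      (Sum.elim (fun R => (d + 1) ^ (R + R) + 1) κ) (Sum.inl : ℕ → ℕ ⊕ J),
      ∀ j, D.ℓ (Sum.inr j) = ℓ j := by
  choose s hs using G.exists_distance_coloring
  refine ⟨{ τ := matchingMap G.graph (s 2)
            ℓ := fun j => match j with
              -- Two words of length at most R from one vertex end at distance at most 2R. The
              -- palette depends only on d and R.
              | Sum.inl R => s (R + R)
              | Sum.inr j => ℓ j
            involutive := matchingMap_involutive (hs 2)
            generates := generates_matchingMap (hs 2)
            proper := matchingMap_proper (hs 2)
            separates := ?_ }, fun j => rfl⟩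
  intro R v w w' hw hw' h
  have hb : ∀ {w : List (Sym2 (Fin ((d + 1) ^ 2 + 1)))}, w.length ≤ R →
      word (matchingMap G.graph (s 2)) w v ∈ ball G.graph R v := fun {w} hw =>
    (generates_matchingMap (hs 2)).mem_ball_iff.2 ⟨w, hw, rfl⟩
  exact hs (R + R) _ _ (ball_trans (mem_ball_comm.1 (hb hw)) (hb hw')) h

/-! ### Clopen approximation in profinite spaces -/

section Approximation

variable {Ω : Type*} [TopologicalSpace Ω]

theorem isLocallyConstant_mem_clopens {ι : Type*} [Finite ι] {B : ι → Set Ω}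
    (hB : ∀ j, IsClopen (B j)) : IsLocallyConstant fun (x : Ω) (j : ι) => x ∈ B j := by
  refine (IsLocallyConstant.iff_eventually_eq _).2 fun x => ?_
  have : ∀ j, ∀ᶠ y in 𝓝 x, (y ∈ B j) = (x ∈ B j) := by
    intro j
    by_cases hx : x ∈ B j
    · filter_upwards [(hB j).isOpen.mem_nhds hx] with y hy
      simp [hx, hy]
    · filter_upwards [(hB j).compl.isOpen.mem_nhds hx] with y hy
      simp only [hx, eq_iff_iff, iff_false]
      exact hy
  filter_upwards [eventually_all.2 this] with y hy
  exact funext hy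

variable [CompactSpace Ω] [T2Space Ω] [TotallyDisconnectedSpace Ω] [SecondCountableTopology Ω]
  [MeasurableSpace Ω] [BorelSpace Ω]

/-- In a second countable profinite space the algebra of clopen sets generates the Borel sets, hence
is dense in measure. -/
theorem exists_isClopen_symmDiff_lt (ν : Measure Ω) [IsFiniteMeasure ν] {A : Set Ω}
    (hA : MeasurableSet A) {δ : ℝ} (hδ : 0 < δ) :
    ∃ B : Set Ω, IsClopen B ∧ ν.real (symmDiff A B) < δ := by
  have halg : IsSetAlgebra {s : Set Ω | IsClopen s} :=
    ⟨isClopen_empty, fun _ h => h.compl, fun _ _ h h' => h.union h'⟩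
  have hgen : (inferInstance : MeasurableSpace Ω) =
      MeasurableSpace.generateFrom {s : Set Ω | IsClopen s} := by
    rw [BorelSpace.measurable_eq (α := Ω)]
    exact isTopologicalBasis_isClopen.borel_eq_generateFrom
  obtain ⟨B, hB, h⟩ := (Measure.MeasureDense.of_generateFrom_isSetAlgebra_finite ν halg hgen).approx
    A hA (measure_ne_top _ _) δ hδ
  refine ⟨B, hB, ?_⟩
  rw [measureReal_def]
  exact (ENNReal.lt_ofReal_iff_toReal_lt (measure_ne_top _ _)).1 h

/-- Measurable colourings of a profinite space are approximated by locally constant ones. -/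
theorem exists_isLocallyConstant_approx (ν : Measure Ω) [IsFiniteMeasure ν] {k : ℕ}
    {f : Ω → Fin (k + 1)} (hf : Measurable f) {δ : ℝ} (hδ : 0 < δ) :
    ∃ g : Ω → Fin (k + 1), IsLocallyConstant g ∧ ν.real {x | f x ≠ g x} ≤ δ := by
  classical
  choose B hB hlt using fun j : Fin (k + 1) => exists_isClopen_symmDiff_lt ν
    (hf (measurableSet_singleton j)) (show 0 < δ / (k + 1) by positivity)
  -- The default 0, and the arbitrary choice when several sets contain the point, matter only on the
  -- union of the symmetric differences.
  let F : (Fin (k + 1) → Prop) → Fin (k + 1) := fun p => if h : ∃ j, p j then h.choose else 0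
  refine ⟨fun x => F fun j => x ∈ B j, (isLocallyConstant_mem_clopens hB).comp F, ?_⟩
  have hsub : {x | f x ≠ F fun j => x ∈ B j} ⊆
      ⋃ j ∈ (Finset.univ : Finset (Fin (k + 1))), symmDiff (f ⁻¹' {j}) (B j) := by
    intro x hx
    by_contra hcon
    simp only [Finset.mem_univ, Set.iUnion_true, Set.mem_iUnion, not_exists, Set.mem_symmDiff,
      Set.mem_preimage, Set.mem_singleton_iff] at hcon
    have hiff : ∀ j, x ∈ B j ↔ f x = j := fun j => by
      have := hcon j
      tauto
    have hex : ∃ j, x ∈ B j := ⟨f x, (hiff _).2 rfl⟩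
    refine hx ?_
    simp only [F, dif_pos hex]
    exact (hiff _).1 hex.choose_spec
  calc ν.real {x | f x ≠ F fun j => x ∈ B j}
      ≤ ν.real (⋃ j ∈ (Finset.univ : Finset (Fin (k + 1))), symmDiff (f ⁻¹' {j}) (B j)) :=
        measureReal_mono hsub (measure_ne_top _ _)
    _ ≤ ∑ j : Fin (k + 1), ν.real (symmDiff (f ⁻¹' {j}) (B j)) :=
        measureReal_biUnion_finset_le _ _
    _ ≤ ∑ _j : Fin (k + 1), δ / (k + 1) := Finset.sum_le_sum fun j _ => (hlt j).le
    _ = δ := by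
      rw [Finset.sum_const, Finset.card_univ, Fintype.card_fin, nsmul_eq_mul]
      push_cast
      field_simp

end Approximation

/-! ### Measure-preserving involutions and mass transport -/

section InvolutionSystem

theorem neighborSet_inter_eq_image {C Ω : Type*} {τ : C → Ω → Ω} {G : SimpleGraph Ω}
    (hG : Generates τ G) (x : Ω) (B : Set Ω) :
    G.neighborSet x ∩ B = (fun c => τ c x) '' {c | τ c x ≠ x ∧ τ c x ∈ B} := by
  ext y
  simp only [Set.mem_inter_iff, SimpleGraph.mem_neighborSet, hG x y, Set.mem_image,
    Set.mem_ofPred_eq]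
  constructor
  · rintro ⟨⟨hne, c, rfl⟩, hB⟩
    exact ⟨c, ⟨hne.symm, hB⟩, rfl⟩
  · rintro ⟨c, ⟨hne, hB⟩, rfl⟩
    exact ⟨⟨hne.symm, c, rfl⟩, hB⟩

-- By `hproper`, distinct letters moving x give distinct neighbours, so neighbours can be counted by
-- letters.
open Classical in
theorem encard_neighborSet_inter {C Ω : Type*} {τ : C → Ω → Ω} {G : SimpleGraph Ω} [Fintype C]
    (hG : Generates τ G)
    (hproper : ∀ c c' x, τ c x = τ c' x → τ c x ≠ x → c = c') (x : Ω) (B : Set Ω) :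
    ((G.neighborSet x ∩ B).encard : ℝ≥0∞) =
      ∑ c, {x | τ c x ≠ x ∧ τ c x ∈ B}.indicator 1 x := by
  rw [neighborSet_inter_eq_image hG, Set.InjOn.encard_image, Set.encard_eq_coe_toFinset_card]
  · simp [Set.indicator_apply]
  · intro c hc c' _ h
    exact hproper c c' x h hc.1

variable {C Ω : Type} [MeasurableSpace Ω] {ν : Measure Ω} {τ : C → Ω → Ω} {G : SimpleGraph Ω}

theorem measurePreserving_word (hτ : ∀ c, MeasurePreserving (τ c) ν ν) (w : List C) :
    MeasurePreserving (word τ w) ν ν := by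
  induction w with
  | nil => exact MeasurePreserving.id ν
  | cons c w ih => exact ih.comp (hτ c)

/-- The local statistics depend continuously on the colouring, with respect to the measure of the
set where two colourings differ. -/
theorem dist_localStatistic_le_of_generates [Finite C] [IsProbabilityMeasure ν]
    (hτ : ∀ c, MeasurePreserving (τ c) ν ν) (hG : Generates τ G) (r : ℕ) {k : ℕ}
    {f g : Ω → Fin k} (hf : Measurable f) (hg : Measurable g) :
    dist (localStatistic ν G r f) (localStatistic ν G r g) ≤
      (List.finite_length_le C r).toFinset.card * ν.real {x | f x ≠ g x} := by
  refine (dist_localStatistic_le _ _ _ _ _ _).trans ?_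
  -- The class at x changes only if some word of length at most r leads from x to a point where the
  -- colours differ; each word preserves ν.
  have hsub : {x | neighborhoodClass G r f x ≠ neighborhoodClass G r g x} ⊆
      ⋃ w ∈ (List.finite_length_le C r).toFinset, word τ w ⁻¹' {x | f x ≠ g x} := by
    intro x hx
    by_contra hcon
    simp only [Set.mem_iUnion, Set.Finite.mem_toFinset, Set.mem_ofPred_eq, Set.mem_preimage,
      not_exists, not_not] at hcon
    refine hx (neighborhoodClass_congr rfl (fun _ _ _ _ => Iff.rfl) fun u hu => ?_)
    obtain ⟨w, hw, rfl⟩ := hG.mem_ball_iff.1 hu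
    exact hcon w hw
  have hm : MeasurableSet {x | f x ≠ g x} := (measurableSet_eq_fun hf hg).compl
  calc _ ≤ ν.real (⋃ w ∈ (List.finite_length_le C r).toFinset, word τ w ⁻¹' {x | f x ≠ g x}) :=
        measureReal_mono hsub (measure_ne_top _ _)
    _ ≤ ∑ w ∈ (List.finite_length_le C r).toFinset, ν.real (word τ w ⁻¹' {x | f x ≠ g x}) :=
        measureReal_biUnion_finset_le _ _
    _ = _ := by
      rw [Finset.sum_congr rfl fun w _ => (measurePreserving_word hτ w).measureReal_preimage
        hm.nullMeasurableSet, Finset.sum_const, nsmul_eq_mul]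

theorem lintegral_encard_neighborSet_inter [Fintype C] (hG : Generates τ G)
    (hproper : ∀ c c' x, τ c x = τ c' x → τ c x ≠ x → c = c')
    (hτ : ∀ c, Measurable (τ c)) (hfix : ∀ c, MeasurableSet {x | τ c x = x})
    (A : Set Ω) {B : Set Ω} (hB : MeasurableSet B) :
    ∫⁻ x in A, ((G.neighborSet x ∩ B).encard : ℝ≥0∞) ∂ν =
      ∑ c, ν ({x | τ c x ≠ x ∧ τ c x ∈ B} ∩ A) := by
  have hm : ∀ c, MeasurableSet {x | τ c x ≠ x ∧ τ c x ∈ B} := fun c =>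
    (hfix c).compl.inter (hτ c hB)
  simp_rw [encard_neighborSet_inter hG hproper]
  rw [lintegral_finsetSum _ fun c _ => measurable_one.indicator (hm c)]
  refine Finset.sum_congr rfl fun c _ => ?_
  rw [lintegral_indicator_one (hm c), Measure.restrict_apply (hm c)]

/-- The identity holds letter by letter: the involution `τ c` exchanges the points of A that it
moves into B with the points of B that it moves into A, and it preserves ν. -/
theorem mass_transport [Fintype C] (hG : Generates τ G)
    (hproper : ∀ c c' x, τ c x = τ c' x → τ c x ≠ x → c = c')
    (hinv : ∀ c, Function.Involutive (τ c)) (hτ : ∀ c, MeasurePreserving (τ c) ν ν)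
    (hfix : ∀ c, MeasurableSet {x | τ c x = x}) {A B : Set Ω}
    (hA : MeasurableSet A) (hB : MeasurableSet B) :
    ∫⁻ x in A, ((G.neighborSet x ∩ B).encard : ℝ≥0∞) ∂ν =
      ∫⁻ x in B, ((G.neighborSet x ∩ A).encard : ℝ≥0∞) ∂ν := by
  rw [lintegral_encard_neighborSet_inter hG hproper (fun c => (hτ c).measurable) hfix A hB,
    lintegral_encard_neighborSet_inter hG hproper (fun c => (hτ c).measurable) hfix B hA]
  refine Finset.sum_congr rfl fun c _ => ?_
  have hm : MeasurableSet ({x | τ c x ≠ x ∧ τ c x ∈ A} ∩ B) :=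
    ((hfix c).compl.inter ((hτ c).measurable hA)).inter hB
  rw [← (hτ c).measure_preimage hm.nullMeasurableSet]
  congr 1
  ext x
  simp only [Set.mem_inter_iff, Set.mem_ofPred_eq, Set.mem_preimage, hinv c x]
  rw [ne_comm]
  tauto

end InvolutionSystem

/-- Families of labels indexed by words. -/
abbrev LabelSpace (C : Type) {J : Type} (κ : J → ℕ) : Type := List C → ∀ j : J, Fin (κ j)

/-- The labels of the vertices reached from `v`. -/
def Decoration.code {d : ℕ} {G : BoundedDegreeGraph d} {C J : Type} {κ : J → ℕ} {sep : ℕ → J}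
    (D : Decoration G C κ sep) (v : Fin G.card) : LabelSpace C κ :=
  fun w j => D.ℓ j (word D.τ w v)

/-! ### The limit graphing on the closure of the codes -/

section Limit

variable {d : ℕ} {ι C J : Type} {κ : J → ℕ} {sep : ℕ → J}
  {G : ι → BoundedDegreeGraph d} (D : ∀ i, Decoration (G i) C κ sep)

/-- The closure of the codes of all vertices of the graphs `G i`. -/
def codeClosure : Set (LabelSpace C κ) := closure (⋃ i, Set.range (D i).code)

/-- Fixing finitely many coordinates gives a neighbourhood in the product topology. This is the
transfer principle: what finitely many labels of a vertex show passes to the limit space. -/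
theorem exists_code_eq {x : LabelSpace C κ} (hx : x ∈ codeClosure D)
    (F : Set (List C × J)) (hF : F.Finite) :
    ∃ i v, ∀ p ∈ F, (D i).code v p.1 p.2 = x p.1 p.2 := by
  have hmem : {y : LabelSpace C κ | ∀ p ∈ F, y p.1 p.2 = x p.1 p.2} ∈ 𝓝 x := by
    change ∀ᶠ y in 𝓝 x, ∀ p ∈ F, y p.1 p.2 = x p.1 p.2
    rw [eventually_all_finite hF]
    intro p _
    have hc : Continuous fun y : LabelSpace C κ => y p.1 p.2 := by fun_prop
    exact hc.continuousAt.eventually_mem ((isOpen_discrete {x p.1 p.2}).mem_nhds rfl)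
  obtain ⟨_, hy, hy'⟩ := mem_closure_iff_nhds.1 hx _ hmem
  obtain ⟨i, v, rfl⟩ := Set.mem_iUnion.1 hy'
  exact ⟨i, v, hy⟩

/-- The action of a letter on families of labels. -/
def shift (c : C) (x : LabelSpace C κ) : LabelSpace C κ := fun w => x (c :: w)

theorem continuous_shift (c : C) : Continuous (shift (κ := κ) c) :=
  continuous_pi fun w => continuous_apply (c :: w)

theorem shift_code {i : ι} (c : C) (v : Fin (G i).card) :
    shift c ((D i).code v) = (D i).code ((D i).τ c v) := rfl

theorem shift_mem {c : C} {x : LabelSpace C κ} (hx : x ∈ codeClosure D) :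
    shift c x ∈ codeClosure D := by
  refine map_mem_closure (continuous_shift c) hx ?_
  intro y hy
  obtain ⟨i, v, rfl⟩ := Set.mem_iUnion.1 hy
  exact Set.mem_iUnion.2 ⟨i, (D i).τ c v, shift_code D c v⟩

/-- The underlying space of the limit graphing. -/
abbrev Carrier : Type := codeClosure D

/-- The involutions of the limit space. -/
def limitMap (c : C) (x : Carrier D) : Carrier D := ⟨shift c x.1, shift_mem D x.2⟩

/-- The labels of the limit space. -/
def limitLabel (j : J) (x : Carrier D) : Fin (κ j) := x.1 [] j

/-- The point of the limit space given by a vertex of one of the graphs. -/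
def toCarrier (i : ι) (v : Fin (G i).card) : Carrier D :=
  ⟨(D i).code v, subset_closure (Set.mem_iUnion.2 ⟨i, v, rfl⟩)⟩

theorem continuous_limitMap (c : C) : Continuous (limitMap D c) :=
  ((continuous_shift c).comp continuous_subtype_val).subtype_mk _

theorem isLocallyConstant_limitLabel (j : J) : IsLocallyConstant (limitLabel D j) := by
  have h : Continuous fun x : LabelSpace C κ => x [] j := by fun_prop
  exact (IsLocallyConstant.iff_continuous _).2 (h.comp continuous_subtype_val)

theorem word_limitMap_val (w : List C) (x : Carrier D) (w' : List C) :
    (word (limitMap D) w x).1 w' = x.1 (w ++ w') := by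
  induction w generalizing x with
  | nil => rfl
  | cons c w ih => exact ih _

theorem limitLabel_word (j : J) (w : List C) (x : Carrier D) :
    limitLabel D j (word (limitMap D) w x) = x.1 w j := by
  rw [limitLabel, word_limitMap_val, List.append_nil]

theorem word_toCarrier (i : ι) (w : List C) (v : Fin (G i).card) :
    word (limitMap D) w (toCarrier D i v) = toCarrier D i (word (D i).τ w v) := by
  induction w generalizing v with
  | nil => rfl
  | cons c w ih => exact ih _

theorem continuous_word_limitMap (w : List C) : Continuous (word (limitMap D) w) := by
  induction w with
  | nil => exact continuous_id
  | cons c w ih => exact ih.comp (continuous_limitMap D c)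

theorem limitMap_involutive (c : C) : Function.Involutive (limitMap D c) := by
  intro x
  refine Subtype.ext (funext fun w => funext fun j => ?_)
  obtain ⟨i, v, h⟩ := exists_code_eq D x.2 {(c :: c :: w, j), (w, j)} (Set.toFinite _)
  have h1 := h _ (Or.inl rfl)
  have h2 := h _ (Or.inr rfl)
  change x.1 (c :: c :: w) j = x.1 w j
  simp only [Decoration.code, word_cons, (D i).involutive c v] at h1 h2
  rw [← h1, ← h2]

/-- Equality in the limit is checked one coordinate at a time. A single vertex witnesses that
coordinate for both words together with the two separating labels. -/
theorem separates_limitMap (R : ℕ) : Separates (limitMap D) (limitLabel D (sep R)) R := by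
  intro x w w' hw hw' heq
  rw [limitLabel_word, limitLabel_word] at heq
  refine Subtype.ext (funext fun u => funext fun j => ?_)
  rw [word_limitMap_val, word_limitMap_val]
  obtain ⟨i, v, h⟩ := exists_code_eq D x.2
    {(w, sep R), (w', sep R), (w ++ u, j), (w' ++ u, j)} (Set.toFinite _)
  have h1 := h (w, sep R) (by simp)
  have h2 := h (w', sep R) (by simp)
  have h3 := h (w ++ u, j) (by simp)
  have h4 := h (w' ++ u, j) (by simp)
  simp only [Decoration.code, word_append] at h1 h2 h3 h4
  have h5 := (D i).separates R v w w' hw hw' (by rw [h1, h2, heq])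
  rw [← h3, ← h4, h5]

/-- Near the root, the points of the limit space look like vertices of one of the graphs. -/
theorem exists_vertex_eq_iff [Finite C] (x : Carrier D) :
    ∃ i, ∃ v : Fin (G i).card, (∀ c, limitMap D c x = x ↔ (D i).τ c v = v) ∧
      ∀ c c', limitMap D c x = limitMap D c' x ↔ (D i).τ c v = (D i).τ c' v := by
  obtain ⟨i, v, h⟩ := exists_code_eq D x.2 {p | p.1.length ≤ 1 ∧ p.2 = sep 1}
    (((List.finite_length_le C 1).prod (Set.finite_singleton (sep 1))).subset fun p hp => hp)
  have key : ∀ w w' : List C, w.length ≤ 1 → w'.length ≤ 1 →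
      (word (limitMap D) w x = word (limitMap D) w' x ↔
        word (D i).τ w v = word (D i).τ w' v) := by
    intro w w' hw hw'
    have h1 := h (w, sep 1) ⟨hw, rfl⟩
    have h2 := h (w', sep 1) ⟨hw', rfl⟩
    simp only [Decoration.code, ← limitLabel_word] at h1 h2
    constructor
    · intro heq
      exact (D i).separates 1 v w w' hw hw' (by rw [h1, h2, heq])
    · intro heq
      exact separates_limitMap D 1 x w w' hw hw' (by rw [← h1, ← h2, heq])
  exact ⟨i, v, fun c => key [c] [] le_rfl (Nat.zero_le 1), fun c c' => key [c] [c'] le_rfl le_rfl⟩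

theorem limitMap_proper [Finite C] (c c' : C) (x : Carrier D) (h : limitMap D c x = limitMap D c' x)
    (hx : limitMap D c x ≠ x) : c = c' := by
  obtain ⟨i, v, h1, h2⟩ := exists_vertex_eq_iff D x
  exact (D i).proper ((h2 c c').1 h) fun hv => hx ((h1 c).2 hv)

/-- The graph generated by the involutions of the limit space. -/
def limitGraph : SimpleGraph (Carrier D) where
  Adj x y := x ≠ y ∧ ∃ c, limitMap D c x = y
  symm := ⟨fun x y ⟨hne, c, hc⟩ => ⟨hne.symm, c, by rw [← hc, limitMap_involutive D c x]⟩⟩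
  loopless := ⟨fun _ h => h.1 rfl⟩

theorem generates_limitMap : Generates (limitMap D) (limitGraph D) := fun _ _ => Iff.rfl

/-- The letters moving x are those moving some vertex v of a finite graph, and there properness
sends them to distinct neighbours of v. -/
theorem encard_neighborSet_limitGraph_le [Finite C] (x : Carrier D) :
    ((limitGraph D).neighborSet x).encard ≤ d := by
  obtain ⟨i, v, h1, -⟩ := exists_vertex_eq_iff D x
  have himg := neighborSet_inter_eq_image (generates_limitMap D) x Set.univ
  rw [Set.inter_univ] at himg
  have hset : {c | limitMap D c x ≠ x ∧ limitMap D c x ∈ Set.univ} = {c | (D i).τ c v ≠ v} := by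
    ext c
    simp [h1 c]
  rw [himg, hset]
  refine Set.encard_image_le _ _ |>.trans ?_
  have hinj : Set.InjOn (fun c => (D i).τ c v) {c | (D i).τ c v ≠ v} :=
    fun c hc c' _ h => (D i).proper h hc
  rw [← hinj.encard_image]
  have hsub : (fun c => (D i).τ c v) '' {c | (D i).τ c v ≠ v} ⊆ (G i).graph.neighborSet v := by
    rintro _ ⟨c, hc, rfl⟩
    exact ((D i).generates _ _).2 ⟨Ne.symm hc, c, rfl⟩
  refine (Set.encard_le_encard hsub).trans ?_
  rw [← (Set.toFinite _).cast_ncard_eq]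
  exact_mod_cast (G i).ncard_neighborSet_le v

instance : CompactSpace (Carrier D) := isCompact_iff_compactSpace.1 isClosed_closure.isCompact

instance [Countable C] [Countable J] : PolishSpace (Carrier D) :=
  (isClosed_closure : IsClosed (codeClosure D)).polishSpace

instance [Countable C] [Countable J] : BorelSpace (Carrier D) := Subtype.borelSpace _

/-- The neighbourhood of a vertex in a finite graph is that of its image in the limit space. -/
theorem neighborhoodClass_toCarrier (i : ι) (r : ℕ) {k : ℕ} (g : Carrier D → Fin k)
    (v : Fin (G i).card) :
    neighborhoodClass (G i).graph r (g ∘ toCarrier D i) v =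
      neighborhoodClass (limitGraph D) r g (toCarrier D i v) := by
  refine neighborhoodClass_eq_of_pattern (D i).generates (generates_limitMap D)
    ((D i).separates (r + 1)) (separates_limitMap D (r + 1)) (fun w _ => ?_) fun w _ => ?_
  · rw [limitLabel_word]
    rfl
  · rw [word_toCarrier, Function.comp_apply]

/-- The class is determined by the separating labels along words of length at most r + 1 and the
colours along words of length at most r: finitely many locally constant data. -/
theorem isLocallyConstant_neighborhoodClass [Finite C] (r : ℕ) {k : ℕ} {g : Carrier D → Fin k}
    (hg : IsLocallyConstant g) :
    IsLocallyConstant fun x => neighborhoodClass (limitGraph D) r g x := by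
  refine (IsLocallyConstant.iff_eventually_eq _).2 fun x => ?_
  have h1 : ∀ᶠ y in 𝓝 x, ∀ w ∈ {w : List C | w.length ≤ r + 1},
      limitLabel D (sep (r + 1)) (word (limitMap D) w y) =
        limitLabel D (sep (r + 1)) (word (limitMap D) w x) :=
    (eventually_all_finite (List.finite_length_le C (r + 1))).2 fun w _ =>
      ((isLocallyConstant_limitLabel D _).comp_continuous
        (continuous_word_limitMap D w)).eventually_eq x
  have h2 : ∀ᶠ y in 𝓝 x, ∀ w ∈ {w : List C | w.length ≤ r},
      g (word (limitMap D) w y) = g (word (limitMap D) w x) :=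
    (eventually_all_finite (List.finite_length_le C r)).2 fun w _ =>
      (hg.comp_continuous (continuous_word_limitMap D w)).eventually_eq x
  filter_upwards [h1, h2] with y hy1 hy2
  exact neighborhoodClass_eq_of_pattern (generates_limitMap D) (generates_limitMap D)
    (separates_limitMap D (r + 1)) (separates_limitMap D (r + 1)) hy1 hy2

end Limit

theorem measurePreserving_uniformOn_univ {V : Type*} [Fintype V] [Nonempty V] [MeasurableSpace V]
    [DiscreteMeasurableSpace V] {f : V → V} (hf : Function.Bijective f) :
    MeasurePreserving f (uniformOn (Set.univ : Set V)) (uniformOn (Set.univ : Set V)) := by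
  refine ⟨Measurable.of_discrete, Measure.ext fun s hs => ?_⟩
  rw [Measure.map_apply Measurable.of_discrete hs, uniformOn_univ, uniformOn_univ,
    ← Measure.count_injective_image hf.1, Set.image_preimage_eq s hf.2]

section Limit

variable {d : ℕ} {ι C J : Type} {κ : J → ℕ} {sep : ℕ → J}
  {G : ι → BoundedDegreeGraph d} (D : ∀ i, Decoration (G i) C κ sep)

/-- The distribution of a random vertex of `G i`, in the limit space. -/
def vertexLaw (i : ι) : ProbabilityMeasure (Carrier D) :=
  ⟨(uniformOn (Set.univ : Set (Fin (G i).card))).map (toCarrier D i),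
    Measure.isProbabilityMeasure_map Measurable.of_discrete.aemeasurable⟩

theorem vertexLaw_real (i : ι) {E : Set (Carrier D)} (hE : MeasurableSet E) :
    ((vertexLaw D i : ProbabilityMeasure (Carrier D)) : Measure (Carrier D)).real E =
      (uniformOn (Set.univ : Set (Fin (G i).card))).real (toCarrier D i ⁻¹' E) :=
  map_measureReal_apply Measurable.of_discrete hE

theorem map_limitMap_vertexLaw [Countable C] [Countable J] (i : ι) (c : C) :
    (vertexLaw D i).map (continuous_limitMap D c).measurable.aemeasurable = vertexLaw D i := by
  refine Subtype.ext ?_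
  change ((uniformOn (Set.univ : Set (Fin (G i).card))).map (toCarrier D i)).map (limitMap D c) =
    (uniformOn (Set.univ : Set (Fin (G i).card))).map (toCarrier D i)
  rw [Measure.map_map (continuous_limitMap D c).measurable Measurable.of_discrete]
  have hcomp : limitMap D c ∘ toCarrier D i = toCarrier D i ∘ (D i).τ c := rfl
  rw [hcomp, ← Measure.map_map Measurable.of_discrete Measurable.of_discrete,
    (measurePreserving_uniformOn_univ ((D i).involutive c).bijective).map_eq]

variable [Countable J] {U : Filter ι} {ν : ProbabilityMeasure (Carrier D)}

/-- Each vertex law is invariant, because coding intertwines the bijection τ c with the shift.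
Invariance survives in the limit since the shift is continuous and weak limits are unique. -/
theorem measurePreserving_limitMap [Countable C] [U.NeBot]
    (hν : Tendsto (vertexLaw D) U (𝓝 ν)) (c : C) :
    MeasurePreserving (limitMap D c) (ν : Measure (Carrier D)) ν := by
  refine ⟨(continuous_limitMap D c).measurable, ?_⟩
  have h1 := ProbabilityMeasure.tendsto_map_of_tendsto_of_continuous _ _ hν
    (continuous_limitMap D c)
  simp_rw [map_limitMap_vertexLaw D] at h1
  have h2 : ν.map (continuous_limitMap D c).measurable.aemeasurable = ν :=
    tendsto_nhds_unique h1 hν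
  exact congrArg (fun μ : ProbabilityMeasure (Carrier D) => (μ : Measure (Carrier D))) h2

/-- The limit of the graphs `G i` given by a limit of the distributions of their vertices. -/
def limitGraphing [Fintype C] [U.NeBot] (hν : Tendsto (vertexLaw D) U (𝓝 ν)) : Graphing d where
  Ω := Carrier D
  ν := ν
  graph := limitGraph D
  measurableSet_edges := by
    have : {p : Carrier D × Carrier D | (limitGraph D).Adj p.1 p.2} =
        {p | p.1 = p.2}ᶜ ∩ ⋃ c, {p | limitMap D c p.1 = p.2} := by
      ext p
      simp [limitGraph]
    rw [this]
    refine (measurableSet_eq_fun measurable_fst measurable_snd).compl.inter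
      (MeasurableSet.iUnion fun c => measurableSet_eq_fun
        ((continuous_limitMap D c).measurable.comp measurable_fst) measurable_snd)
  degree_le := encard_neighborSet_limitGraph_le D
  measure_preserving _ _ hA hB := mass_transport (generates_limitMap D) (limitMap_proper D)
    (limitMap_involutive D) (measurePreserving_limitMap D hν)
    (fun c => measurableSet_eq_fun (continuous_limitMap D c).measurable measurable_id) hA hB

/-- The local statistics of a continuous colouring of the limit space are the limits of those of
the colourings which it induces on the finite graphs. -/
theorem tendsto_dist_localStatistic [Finite C] (hν : Tendsto (vertexLaw D) U (𝓝 ν)) (r : ℕ) {k : ℕ}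
    {g : Carrier D → Fin k} (hg : IsLocallyConstant g) :
    Tendsto (fun i => dist (localStatistic (uniformOn Set.univ) (G i).graph r (g ∘ toCarrier D i))
      (localStatistic (ν : Measure (Carrier D)) (limitGraph D) r g)) U (𝓝 0) := by
  let c : Carrier D → RootedClass k := fun x => neighborhoodClass (limitGraph D) r g x
  have hc : IsLocallyConstant c := isLocallyConstant_neighborhoodClass D r hg
  rw [Metric.tendsto_nhds]
  intro ε hε
  -- A locally constant map on a compact space has finite range, so uniformity over all events
  -- reduces to the subsets of that range, whose preimages are clopen.
  have hfin : {B : Set (RootedClass k) | B ⊆ Set.range c}.Finite := hc.range_finite.finite_subsets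
  have hev : ∀ᶠ i in U, ∀ B ∈ {B : Set (RootedClass k) | B ⊆ Set.range c},
      |((vertexLaw D i : ProbabilityMeasure (Carrier D)) : Measure (Carrier D)).real (c ⁻¹' B) -
        (ν : Measure (Carrier D)).real (c ⁻¹' B)| ≤ ε / 2 := by
    refine (eventually_all_finite hfin).2 fun B _ => ?_
    have hclopen : IsClopen (c ⁻¹' B) := ⟨⟨by rw [← Set.preimage_compl]; exact hc _⟩, hc B⟩
    have h1 := ProbabilityMeasure.tendsto_measure_of_isClopen_of_tendsto hν hclopen
    have h2 := (NNReal.tendsto_coe.2 h1)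
    filter_upwards [Metric.tendsto_nhds.1 h2 (ε / 2) (half_pos hε)] with i hi
    exact hi.le
  filter_upwards [hev] with i hi
  rw [Real.dist_eq, sub_zero, abs_of_nonneg dist_nonneg]
  refine (dist_statistic_le (half_pos hε).le fun A => ?_).trans_lt (half_lt_self hε)
  have h3 := hi (A ∩ Set.range c) Set.inter_subset_right
  rw [Set.preimage_inter_range, vertexLaw_real D i (hc A).measurableSet] at h3
  have h4 : toCarrier D i ⁻¹' (c ⁻¹' A) =
      {v | neighborhoodClass (G i).graph r (g ∘ toCarrier D i) v ∈ A} := by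
    ext v
    rw [Set.mem_ofPred_eq, neighborhoodClass_toCarrier]
    rfl
  rw [h4] at h3
  exact h3

/-- A colouring of `G i` is replaced by a net colouring, which is a continuous function of the code
and so also colours the limit. Conversely, a measurable colouring of the limit is replaced by a
locally constant one, which pulls back to `G i`. -/
theorem tendsto_hausdorffDist_limitGraphing [Fintype C] [U.NeBot]
    (hν : Tendsto (vertexLaw D) U (𝓝 ν))
    {r k : ℕ} (hnet : ∀ ε > 0, ∃ (N : ℕ) (g : Fin N → LabelSpace C κ → Fin (k + 1)),
      (∀ a, Continuous (g a)) ∧ ∀ i (f : Fin (G i).card → Fin (k + 1)), ∃ a,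
        dist (localStatistic (uniformOn Set.univ) (G i).graph r f)
          (localStatistic (uniformOn Set.univ) (G i).graph r (g a ∘ (D i).code)) ≤ ε) :
    Tendsto (fun i => Metric.hausdorffDist ((G i).Q r (k + 1))
      ((limitGraphing D hν).Q r (k + 1))) U (𝓝 0) := by
  rw [Metric.tendsto_nhds]
  intro ε hε
  obtain ⟨N, g, hg, hnet⟩ := hnet (ε / 4) (by positivity)
  let stat : (Carrier D → Fin (k + 1)) → Statistic (k + 1) := fun f =>
    localStatistic (ν : Measure (Carrier D)) (limitGraph D) r f
  have hsubset : stat '' {f | IsLocallyConstant f} ⊆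
      supportedStatistics (ballClasses d r (k + 1)) := by
    rintro _ ⟨f, hf, rfl⟩
    exact (isCompact_supportedStatistics (finite_ballClasses d r (k + 1))).isClosed.mem_of_tendsto
      (tendsto_iff_dist_tendsto_zero.2 (tendsto_dist_localStatistic D hν r hf))
      (Eventually.of_forall fun i => (G i).Q_subset _ _ ⟨_, Measurable.of_discrete, rfl⟩)
  -- A finite net among the statistics of locally constant colourings makes one threshold along U
  -- work for all colourings at once.
  obtain ⟨T, hT, hTfin, hcov⟩ := Metric.finite_approx_of_totallyBounded
    ((isCompact_supportedStatistics (finite_ballClasses d r (k + 1))).totallyBounded.subset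
      hsubset) (ε / 4) (by positivity)
  have hev1 : ∀ᶠ i in U, ∀ p ∈ T, ∃ q ∈ (G i).Q r (k + 1), dist q p < ε / 4 := by
    refine (eventually_all_finite hTfin).2 fun p hp => ?_
    obtain ⟨f, hf, rfl⟩ := hT hp
    filter_upwards [(tendsto_dist_localStatistic D hν r hf).eventually_lt_const
      (show 0 < ε / 4 by positivity)] with i hi
    exact ⟨_, ⟨_, Measurable.of_discrete, rfl⟩, hi⟩
  have hloc : ∀ a, IsLocallyConstant fun x : Carrier D => g a x.1 := fun a =>
    (IsLocallyConstant.iff_continuous _).2 ((hg a).comp continuous_subtype_val)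
  have hev2 : ∀ᶠ i in U, ∀ a, dist
      (localStatistic (uniformOn Set.univ) (G i).graph r (g a ∘ (D i).code))
      (stat fun x => g a x.1) < ε / 4 :=
    eventually_all.2 fun a => (tendsto_dist_localStatistic D hν r (hloc a)).eventually_lt_const
      (show 0 < ε / 4 by positivity)
  filter_upwards [hev1, hev2] with i hi1 hi2
  rw [Real.dist_eq, sub_zero, abs_of_nonneg Metric.hausdorffDist_nonneg]
  refine (Metric.hausdorffDist_le_of_mem_dist (r := 3 * (ε / 4)) (by positivity) ?_ ?_).trans_lt
    (by linarith)
  · rintro _ ⟨f, -, rfl⟩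
    obtain ⟨a, ha⟩ := hnet i f
    refine ⟨stat fun x => g a x.1, ⟨_, (hloc a).continuous.measurable, rfl⟩, ?_⟩
    linarith [hi2 a, dist_triangle (localStatistic (uniformOn Set.univ) (G i).graph r f)
      (localStatistic (uniformOn Set.univ) (G i).graph r (g a ∘ (D i).code))
      (stat fun x => g a x.1)]
  · rintro _ ⟨f, hf, rfl⟩
    let M := (List.finite_length_le C r).toFinset.card
    -- M counts the words of length at most r, so this error in the colouring costs at most ε/4 in
    -- the statistic.
    obtain ⟨f', hf', hff'⟩ := exists_isLocallyConstant_approx (ν : Measure (Carrier D)) hf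
      (show 0 < ε / 4 / (M + 1) by positivity)
    have h1 := dist_localStatistic_le_of_generates (measurePreserving_limitMap D hν)
      (generates_limitMap D) r hf hf'.continuous.measurable
    have h2 : dist (stat f) (stat f') ≤ ε / 4 := by
      refine h1.trans ?_
      calc (M : ℝ) * (ν : Measure (Carrier D)).real {x | f x ≠ f' x}
          ≤ M * (ε / 4 / (M + 1)) := by gcongr
        _ ≤ (M + 1) * (ε / 4 / (M + 1)) := by gcongr; linarith
        _ = ε / 4 := by field_simp
    have h3 := hcov ⟨f', hf', rfl⟩
    simp only [Set.mem_iUnion, Metric.mem_ball] at h3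
    obtain ⟨p, hp, hp'⟩ := h3
    obtain ⟨q, hq, hqp⟩ := hi1 p hp
    refine ⟨q, hq, ?_⟩
    rw [dist_comm] at hqp
    change dist (stat f) q ≤ _
    linarith [dist_triangle4 (stat f) (stat f') p q]

end Limit

/-! ### Every point of the completion is represented by a graphing -/

/-- Local-global convergence to a graphing only depends on the limit in the completion. -/
theorem lgTendsto_of_tendsto {d : ℕ} {ι ι' : Type} {G : ι → BoundedDegreeGraph d} {U : Filter ι}
    [U.NeBot] {H : ι' → BoundedDegreeGraph d} {l : Filter ι'} {x : LimitSpace d} {𝒢 : Graphing d}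
    (hGx : Tendsto (fun i => (G i : LimitSpace d)) U (𝓝 x))
    (hG𝒢 : ∀ r k, Tendsto (fun i => Metric.hausdorffDist ((G i).Q (r + 1) (k + 1))
      (𝒢.Q (r + 1) (k + 1))) U (𝓝 0))
    (hHx : Tendsto (fun i => (H i : LimitSpace d)) l (𝓝 x)) : LGTendsto H l 𝒢 := by
  intro r k hr hk
  obtain ⟨r, rfl⟩ : ∃ r', r = r' + 1 := ⟨r - 1, by omega⟩
  obtain ⟨k, rfl⟩ : ∃ k', k = k' + 1 := ⟨k - 1, by omega⟩
  rw [Metric.tendsto_nhds]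
  intro ε hε
  let c : ℝ := 2 ^ ((k + 1) + (r + 1))
  have hc : 0 < c := by positivity
  have hδ : 0 < ε / (4 * c) := by positivity
  filter_upwards [Metric.tendsto_nhds.1 hHx _ hδ] with i hi
  -- A single `G j` close to x and to 𝒢 serves every `H i` close to x, so convergence along any
  -- nontrivial filter U suffices.
  obtain ⟨j, hj1, hj2⟩ := ((Metric.tendsto_nhds.1 hGx _ hδ).and
    ((hG𝒢 r k).eventually_lt_const (half_pos hε))).exists
  rw [Real.dist_eq, sub_zero, abs_of_nonneg Metric.hausdorffDist_nonneg]
  have h1 : dist (H i) (G j) < ε / (2 * c) := by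
    rw [← UniformSpace.Completion.dist_eq]
    calc _ ≤ dist (H i : LimitSpace d) x + dist (G j : LimitSpace d) x := dist_triangle_right _ _ _
      _ < ε / (4 * c) + ε / (4 * c) := add_lt_add hi hj1
      _ = ε / (2 * c) := by field_simp; norm_num
  have h2 : Metric.hausdorffDist ((H i).Q (r + 1) (k + 1)) ((G j).Q (r + 1) (k + 1)) < ε / 2 := by
    refine ((H i).hausdorffDist_le_dist (G j) r k).trans_lt ?_
    calc c * dist (H i) (G j) < c * (ε / (2 * c)) := by gcongr
      _ = ε / 2 := by field_simp
  have h3 := Metric.hausdorffDist_triangle (u := 𝒢.Q (r + 1) (k + 1))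
    (Metric.hausdorffEDist_ne_top_of_nonempty_of_bounded ((H i).Q_nonempty (r + 1) k)
      ((G j).Q_nonempty (r + 1) k) (BoundedDegreeGraph.isBounded_statistic _)
      (BoundedDegreeGraph.isBounded_statistic _))
  linarith

theorem Graphing.Represents.lgTendsto {d : ℕ} {ι : Type} {H : ι → BoundedDegreeGraph d}
    {l : Filter ι} {x : LimitSpace d} {𝒢 : Graphing d} (h : 𝒢.Represents x)
    (hHx : Tendsto (fun i => (H i : LimitSpace d)) l (𝓝 x)) : LGTendsto H l 𝒢 := by
  obtain ⟨G, hG, hG𝒢⟩ := h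
  exact lgTendsto_of_tendsto hG (fun r k => hG𝒢 _ _ (Nat.le_add_left 1 r) (Nat.le_add_left 1 k)) hHx

/-- Every point of the completion is represented by a graphing. -/
theorem exists_represents {d : ℕ} (x : LimitSpace d) : ∃ 𝒢 : Graphing d, 𝒢.Represents x := by
  obtain ⟨G, hG⟩ : ∃ G : ℕ → BoundedDegreeGraph d,
      Tendsto (fun i => (G i : LimitSpace d)) atTop (𝓝 x) := by
    obtain ⟨y, hy, hyx⟩ := mem_closure_iff_seq_limit.1
      (UniformSpace.Completion.denseRange_coe (α := BoundedDegreeGraph d) x)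
    choose G hG using hy
    exact ⟨G, by simpa only [hG] using hyx⟩
  -- Nets for all radii, all numbers of colours and all precisions 1/(m+1) become additional labels
  -- of one decoration.
  choose N F hF using fun t : ℕ × ℕ × ℕ => BoundedDegreeGraph.exists_coloring_net d t.1 t.2.1
    (show (0 : ℝ) < 1 / ((t.2.2 : ℝ) + 1) by positivity)
  let J := Σ t : ℕ × ℕ × ℕ, Fin (N t)
  let κ : J → ℕ := fun j => j.1.2.1 + 1
  choose D hD using fun i => exists_decoration (κ := κ) (G i) fun j : J => F j.1 (G i) j.2
  -- The ultrafilter only produces a limit of the vertex laws. As the graphs already converge to x,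
  -- convergence along U upgrades to convergence along `atTop`.
  let U : Ultrafilter ℕ := hyperfilter ℕ
  have hU : (U : Filter ℕ) ≤ atTop := Nat.hyperfilter_le_atTop
  obtain ⟨ν, -, hν⟩ := isCompact_univ.ultrafilter_le_nhds (U.map (vertexLaw D))
    (by simp)
  have hν' : Tendsto (vertexLaw D) U (𝓝 ν) := hν
  refine ⟨limitGraphing D hν', G, hG,
    lgTendsto_of_tendsto (hG.mono_left hU) (fun r k => ?_) hG⟩
  refine tendsto_hausdorffDist_limitGraphing D hν' fun ε hε => ?_
  obtain ⟨m, hm⟩ := exists_nat_one_div_lt hε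
  refine ⟨N (r + 1, k, m), fun a y => y [] (Sum.inr ⟨(r + 1, k, m), a⟩), fun a => ?_,
    fun i f => ?_⟩
  · exact (continuous_apply (A := fun j => Fin (Sum.elim (fun R => (d + 1) ^ (R + R) + 1) κ j))
      (Sum.inr ⟨(r + 1, k, m), a⟩)).comp (continuous_apply [])
  · obtain ⟨a, ha⟩ := hF (r + 1, k, m) (G i) f
    exact ⟨a, le_of_eq_of_le (congrArg (fun f' : Fin (G i).card → Fin (k + 1) =>
      dist (localStatistic (uniformOn Set.univ) (G i).graph (r + 1) f)
        (localStatistic (uniformOn Set.univ) (G i).graph (r + 1) f'))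
      (hD i ⟨(r + 1, k, m), a⟩)) (ha.trans hm).le⟩

/-! ### Concentration for functions of a random permutation -/

section Concentration

/-- Hoeffding's lemma: on [-b, b] the exponential lies below its chord, the linear part sums to
zero, and cosh u ≤ exp(u²/2). -/
theorem sum_exp_le_of_sum_eq_zero {ι : Type*} [Fintype ι] {y : ι → ℝ} {b : ℝ} (hsum : ∑ i, y i = 0)
    (hb : ∀ i, |y i| ≤ b) (s : ℝ) :
    ∑ i, Real.exp (s * y i) ≤ Fintype.card ι * Real.exp (s ^ 2 * b ^ 2 / 2) := by
  rcases isEmpty_or_nonempty ι with hι | ⟨⟨i₀⟩⟩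
  · simp
  have hb0 : 0 ≤ b := (abs_nonneg _).trans (hb i₀)
  rcases hb0.eq_or_lt with rfl | hb0
  · have : ∀ i, y i = 0 := fun i => abs_nonpos_iff.1 (hb i)
    simp [this]
  have h1 : ∀ i, Real.exp (s * y i) ≤ Real.cosh (s * b) + y i / b * Real.sinh (s * b) := by
    intro i
    have ht : |y i / b| ≤ 1 := by
      rw [abs_div, abs_of_pos hb0]
      exact (div_le_one hb0).2 (hb i)
    have := Real.exp_mul_le_cosh_add_mul_sinh ht (s * b)
    convert this using 2
    field_simp
  calc ∑ i, Real.exp (s * y i)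
      ≤ ∑ i, (Real.cosh (s * b) + y i / b * Real.sinh (s * b)) := Finset.sum_le_sum fun i _ => h1 i
    _ = Fintype.card ι * Real.cosh (s * b) := by
      rw [Finset.sum_add_distrib, ← Finset.sum_mul, ← Finset.sum_div, hsum]
      simp
    _ ≤ Fintype.card ι * Real.exp (s ^ 2 * b ^ 2 / 2) := by
      gcongr
      have := Real.cosh_le_exp_half_sq (s * b)
      rwa [mul_pow] at this

/-- Conjugation by `swap 0 p` keeps a transposition a transposition. Thus the bound under
transpositions is inherited by the permutations with prescribed value at 0. -/
theorem decomposeFin_symm_swap_mul {N : ℕ} (p : Fin (N + 1)) (a b : Fin N)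
    (π : Equiv.Perm (Fin N)) : ∃ a' b', Equiv.Perm.decomposeFin.symm (p, Equiv.swap a b * π) =
      Equiv.swap a' b' * Equiv.Perm.decomposeFin.symm (p, π) := by
  refine ⟨Equiv.swap 0 p a.succ, Equiv.swap 0 p b.succ, Equiv.ext fun x => ?_⟩
  refine Fin.cases ?_ (fun x => ?_) x
  · rw [Equiv.Perm.mul_apply, Equiv.Perm.decomposeFin_symm_apply_zero,
      Equiv.Perm.decomposeFin_symm_apply_zero, Equiv.swap_apply_of_ne_of_ne]
    · exact fun h => (Fin.succ_ne_zero a) ((Equiv.swap 0 p).injective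
        (by rw [← h, Equiv.swap_apply_left]))
    · exact fun h => (Fin.succ_ne_zero b) ((Equiv.swap 0 p).injective
        (by rw [← h, Equiv.swap_apply_left]))
  · rw [Equiv.Perm.mul_apply, Equiv.Perm.decomposeFin_symm_apply_succ,
      Equiv.Perm.decomposeFin_symm_apply_succ, Equiv.Perm.mul_apply,
      (Equiv.swap (0 : Fin (N + 1)) p).injective.swap_apply,
      (Fin.succ_injective N).swap_apply]

/-- Changing the value at 0 costs two transpositions, which is the source of the factor 2c below. -/
theorem decomposeFin_symm_eq_swap_mul_swap_mul {N : ℕ} (p p' : Fin (N + 1))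
    (π : Equiv.Perm (Fin N)) : Equiv.Perm.decomposeFin.symm (p', π) =
      Equiv.swap 0 p' * (Equiv.swap 0 p * Equiv.Perm.decomposeFin.symm (p, π)) := by
  refine Equiv.ext fun x => ?_
  refine Fin.cases ?_ (fun x => ?_) x
  · simp [Equiv.Perm.mul_apply]
  · simp [Equiv.Perm.mul_apply]

/-- The exponential moments of a function on permutations which changes by at most `c` under
transpositions. -/
theorem sum_exp_perm_le {c : ℝ} {N : ℕ} (F : Equiv.Perm (Fin N) → ℝ)
    (hF : ∀ σ a b, |F (Equiv.swap a b * σ) - F σ| ≤ c) (s : ℝ) :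
    ∑ σ, Real.exp (s * (F σ - (∑ σ, F σ) / N.factorial)) ≤
      N.factorial * Real.exp (2 * s ^ 2 * c ^ 2 * N) := by
  induction N with
  | zero => simp
  | succ N ih =>
    -- The value p at 0 is revealed first: `Φ p` is the remaining function and `g p` the conditional
    -- mean.
    let Φ : Fin (N + 1) → Equiv.Perm (Fin N) → ℝ := fun p π =>
      F (Equiv.Perm.decomposeFin.symm (p, π))
    let g : Fin (N + 1) → ℝ := fun p => (∑ π, Φ p π) / N.factorial
    have hN : (0 : ℝ) < N.factorial := by positivity
    have hsum : ∀ H : Equiv.Perm (Fin (N + 1)) → ℝ,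
        ∑ σ, H σ = ∑ p, ∑ π, H (Equiv.Perm.decomposeFin.symm (p, π)) := by
      intro H
      rw [← Fintype.sum_prod_type', ← Equiv.sum_comp Equiv.Perm.decomposeFin.symm]
    have hg : (∑ σ, F σ) / (N + 1).factorial = (∑ p, g p) / (N + 1) := by
      rw [hsum F, ← Finset.sum_div, Nat.factorial_succ]
      push_cast
      rw [div_div, mul_comm]
    have hgg : ∀ p p', |g p' - g p| ≤ 2 * c := by
      intro p p'
      rw [← sub_div, ← Finset.sum_sub_distrib, abs_div, abs_of_pos hN, div_le_iff₀ hN]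
      calc |∑ π, (Φ p' π - Φ p π)| ≤ ∑ π, |Φ p' π - Φ p π| := Finset.abs_sum_le_sum_abs _ _
        _ ≤ ∑ _π : Equiv.Perm (Fin N), 2 * c := by
          refine Finset.sum_le_sum fun π _ => ?_
          simp only [Φ]
          rw [decomposeFin_symm_eq_swap_mul_swap_mul p p']
          have h1 := hF (Equiv.swap 0 p * Equiv.Perm.decomposeFin.symm (p, π)) 0 p'
          have h2 := hF (Equiv.Perm.decomposeFin.symm (p, π)) 0 p
          have := abs_sub_le (F (Equiv.swap 0 p' * (Equiv.swap 0 p *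
            Equiv.Perm.decomposeFin.symm (p, π)))) (F (Equiv.swap 0 p *
            Equiv.Perm.decomposeFin.symm (p, π))) (F (Equiv.Perm.decomposeFin.symm (p, π)))
          linarith
        _ = 2 * c * N.factorial := by
          rw [Finset.sum_const, Finset.card_univ, Fintype.card_perm, Fintype.card_fin,
            nsmul_eq_mul, mul_comm]
    set m : ℝ := (∑ p, g p) / (N + 1) with hm
    have hy0 : ∑ p, (g p - m) = 0 := by
      rw [Finset.sum_sub_distrib, Finset.sum_const, Finset.card_univ, Fintype.card_fin,
        nsmul_eq_mul, hm]
      push_cast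
      field_simp
      ring
    have hyb : ∀ p, |g p - m| ≤ 2 * c := by
      intro p
      have h1 : g p - m = (∑ p', (g p - g p')) / (N + 1) := by
        rw [Finset.sum_sub_distrib, Finset.sum_const, Finset.card_univ, Fintype.card_fin,
          nsmul_eq_mul, hm]
        push_cast
        field_simp
      rw [h1, abs_div, abs_of_pos (by positivity : (0 : ℝ) < N + 1), div_le_iff₀ (by positivity)]
      calc |∑ p', (g p - g p')| ≤ ∑ p', |g p - g p'| := Finset.abs_sum_le_sum_abs _ _
        _ ≤ ∑ _p' : Fin (N + 1), 2 * c := Finset.sum_le_sum fun p' _ => hgg p' p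
        _ = 2 * c * (N + 1) := by
          rw [Finset.sum_const, Finset.card_univ, Fintype.card_fin, nsmul_eq_mul]
          push_cast
          ring
    have hinner : ∀ p, ∑ π, Real.exp (s * (Φ p π - g p)) ≤
        N.factorial * Real.exp (2 * s ^ 2 * c ^ 2 * N) := by
      intro p
      refine ih (Φ p) fun σ a b => ?_
      obtain ⟨a', b', h⟩ := decomposeFin_symm_swap_mul p a b σ
      simp only [Φ, h]
      exact hF _ _ _
    rw [hg, hsum]
    calc ∑ p, ∑ π, Real.exp (s * (F (Equiv.Perm.decomposeFin.symm (p, π)) - m))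
        = ∑ p, (∑ π, Real.exp (s * (Φ p π - g p))) * Real.exp (s * (g p - m)) := by
          refine Finset.sum_congr rfl fun p _ => ?_
          rw [Finset.sum_mul]
          refine Finset.sum_congr rfl fun π _ => ?_
          rw [← Real.exp_add]
          congr 1
          ring
      _ ≤ ∑ p, (N.factorial * Real.exp (2 * s ^ 2 * c ^ 2 * N)) * Real.exp (s * (g p - m)) := by
          gcongr with p
          exact hinner p
      _ = (N.factorial * Real.exp (2 * s ^ 2 * c ^ 2 * N)) * ∑ p, Real.exp (s * (g p - m)) := by
          rw [Finset.mul_sum]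
      -- Hoeffding's lemma with b = 2c: each revealed value contributes exp(2s²c²).
      _ ≤ (N.factorial * Real.exp (2 * s ^ 2 * c ^ 2 * N)) *
          (Fintype.card (Fin (N + 1)) * Real.exp (s ^ 2 * (2 * c) ^ 2 / 2)) := by
          gcongr
          exact sum_exp_le_of_sum_eq_zero hy0 hyb s
      _ = (N + 1).factorial * Real.exp (2 * s ^ 2 * c ^ 2 * (N + 1 : ℕ)) := by
          rw [Fintype.card_fin, Nat.factorial_succ, mul_mul_mul_comm, ← Real.exp_add]
          push_cast
          rw [mul_comm (N.factorial : ℝ)]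
          congr 2
          ring

theorem card_perm_sub_ge_le {c : ℝ} (hc : 0 < c) {N : ℕ} (hN : 0 < N) (F : Equiv.Perm (Fin N) → ℝ)
    (hF : ∀ σ a b, |F (Equiv.swap a b * σ) - F σ| ≤ c) {t : ℝ} (ht : 0 ≤ t) :
    ({σ | t ≤ F σ - (∑ σ, F σ) / N.factorial}.ncard : ℝ) ≤
      N.factorial * Real.exp (-(t ^ 2 / (8 * c ^ 2 * N))) := by
  classical
  have hN' : (0 : ℝ) < N := by exact_mod_cast hN
  set m := (∑ σ, F σ) / N.factorial
  -- This s minimises 2s²c²N - st, with minimum -t²/(8c²N).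
  set s : ℝ := t / (4 * c ^ 2 * N) with hs
  have hs0 : 0 ≤ s := by positivity
  have h1 := sum_exp_perm_le F hF s
  have h2 : ({σ | t ≤ F σ - m}.ncard : ℝ) * Real.exp (s * t) ≤ ∑ σ, Real.exp (s * (F σ - m)) := by
    rw [Set.ncard_eq_toFinset_card', ← nsmul_eq_mul, ← Finset.sum_const]
    refine (Finset.sum_le_sum fun σ hσ => ?_).trans
      (Finset.sum_le_sum_of_subset_of_nonneg (Finset.subset_univ _) fun _ _ _ => (Real.exp_pos _).le)
    rw [Set.mem_toFinset, Set.mem_ofPred_eq] at hσ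
    gcongr
  have h3 : Real.exp (-(t ^ 2 / (8 * c ^ 2 * N))) =
      Real.exp (2 * s ^ 2 * c ^ 2 * N) / Real.exp (s * t) := by
    rw [← Real.exp_sub]
    congr 1
    rw [hs]
    field_simp
    ring
  rw [h3, ← mul_div_assoc, le_div_iff₀ (Real.exp_pos _)]
  exact h2.trans h1

/-- Functions on bijections which change by at most `c` under transpositions are concentrated. -/
theorem exists_card_equiv_abs_sub_ge_le {α β : Type*} [Fintype α] [Fintype β] [DecidableEq α]
    [DecidableEq β] {N : ℕ} (hN : 0 < N) (hα : Fintype.card α = N) (hβ : Fintype.card β = N)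
    {c : ℝ} (hc : 0 < c) (F : α ≃ β → ℝ)
    (hF : ∀ σ a b, |F (σ.trans (Equiv.swap a b)) - F σ| ≤ c) :
    ∃ m : ℝ, ∀ t : ℝ, 0 ≤ t → ({σ | t ≤ |F σ - m|}.ncard : ℝ) ≤
      2 * N.factorial * Real.exp (-(t ^ 2 / (8 * c ^ 2 * N))) := by
  let e : (α ≃ β) ≃ Equiv.Perm (Fin N) :=
    Equiv.equivCongr (Fintype.equivFinOfCardEq hα) (Fintype.equivFinOfCardEq hβ)
  let F' : Equiv.Perm (Fin N) → ℝ := fun π => F (e.symm π)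
  have hF' : ∀ σ a b, |F' (Equiv.swap a b * σ) - F' σ| ≤ c := by
    intro σ a b
    have : e.symm (Equiv.swap a b * σ) = (e.symm σ).trans (Equiv.swap
        ((Fintype.equivFinOfCardEq hβ).symm a) ((Fintype.equivFinOfCardEq hβ).symm b)) := by
      ext x
      simp [e, Equiv.equivCongr, ← (Fintype.equivFinOfCardEq hβ).symm.injective.swap_apply]
    simp only [F', this]
    exact hF _ _ _
  have hF'' : ∀ σ a b, |-F' (Equiv.swap a b * σ) - -F' σ| ≤ c := by
    intro σ a b
    rw [← neg_sub', abs_neg]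
    exact hF' σ a b
  set m := (∑ σ, F' σ) / N.factorial with hm
  refine ⟨m, fun t ht => ?_⟩
  have h1 := card_perm_sub_ge_le hc hN F' hF' ht
  have h2 := card_perm_sub_ge_le hc hN (fun σ => -F' σ) hF'' ht
  have hset : {σ | t ≤ |F σ - m|} = e.symm '' ({π | t ≤ F' π - m} ∪ {π | t ≤ -F' π - -m}) := by
    ext σ
    constructor
    · intro h
      refine ⟨e σ, ?_, e.symm_apply_apply σ⟩
      rw [Set.mem_ofPred_eq, le_abs] at h
      simp only [F', Set.mem_union, Set.mem_ofPred_eq, Equiv.symm_apply_apply]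
      rcases h with h | h
      · exact Or.inl h
      · exact Or.inr (by linarith)
    · rintro ⟨π, h, rfl⟩
      rw [Set.mem_ofPred_eq, le_abs]
      rcases h with h | h
      · exact Or.inl h
      · rw [Set.mem_ofPred_eq] at h
        exact Or.inr (by simp only [F'] at h; linarith)
  rw [hset, Set.ncard_image_of_injective _ e.symm.injective]
  have hneg : (∑ σ, -F' σ) / N.factorial = -m := by
    rw [Finset.sum_neg_distrib, neg_div]
  rw [hneg] at h2
  have h3 : (({π | t ≤ F' π - m} ∪ {π | t ≤ -F' π - -m}).ncard : ℝ) ≤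
      {π | t ≤ F' π - m}.ncard + {π | t ≤ -F' π - -m}.ncard := by
    exact_mod_cast Set.ncard_union_le _ _
  linarith

end Concentration

/-! ### The configuration model -/

section Configuration

variable {m n d : ℕ}

/-- The simple graph underlying the multigraph obtained by pairing the half-edges `Fin n × Fin d`
according to a bijection with the ends of `m` edges. -/
def configGraph (σ : Fin m × Bool ≃ Fin n × Fin d) : SimpleGraph (Fin n) where
  Adj u v := u ≠ v ∧ ∃ e b, (σ (e, b)).1 = u ∧ (σ (e, !b)).1 = v
  symm := ⟨fun u v ⟨hne, e, b, h1, h2⟩ => ⟨hne.symm, e, !b, h2, by rwa [Bool.not_not]⟩⟩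
  loopless := ⟨fun _ h => h.1 rfl⟩

theorem ncard_neighborSet_configGraph_le (σ : Fin m × Bool ≃ Fin n × Fin d) (u : Fin n) :
    ((configGraph σ).neighborSet u).ncard ≤ d := by
  have hsub : (configGraph σ).neighborSet u ⊆
      (fun i : Fin d => (σ ((σ.symm (u, i)).1, !(σ.symm (u, i)).2)).1) '' Set.univ := by
    rintro v ⟨-, e, b, rfl, rfl⟩
    exact ⟨(σ (e, b)).2, trivial, by simp⟩
  refine (Set.ncard_le_ncard hsub (Set.toFinite _)).trans
    ((Set.ncard_image_le (Set.toFinite _)).trans ?_)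
  rw [Set.ncard_univ, Nat.card_fin]

/-- The graph of a configuration as an element of `X_d`. -/
def configBounded (hn : 0 < n) (σ : Fin m × Bool ≃ Fin n × Fin d) : BoundedDegreeGraph d where
  card := n
  card_pos := hn
  graph := configGraph σ
  degree_le v := by
    classical
    rw [← SimpleGraph.card_neighborSet_eq_degree, ← Nat.card_eq_fintype_card,
      Nat.card_coe_set_eq]
    exact ncard_neighborSet_configGraph_le σ v

theorem configGraph_adj_of_swap {σ : Fin m × Bool ≃ Fin n × Fin d} {a b : Fin n × Fin d}
    {u v : Fin n} (hu : u ∉ ({a.1, b.1} : Set (Fin n))) (hv : v ∉ ({a.1, b.1} : Set (Fin n))) :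
    (configGraph σ).Adj u v ↔ (configGraph (σ.trans (Equiv.swap a b))).Adj u v := by
  have key : ∀ (x : Fin n × Fin d) (w : Fin n), w ∉ ({a.1, b.1} : Set (Fin n)) →
      (x.1 = w ↔ (Equiv.swap a b x).1 = w) := by
    intro x w hw
    simp only [Set.mem_insert_iff, Set.mem_singleton_iff, not_or] at hw
    rcases eq_or_ne x a with rfl | hxa
    · rw [Equiv.swap_apply_left]
      exact ⟨fun h => absurd h.symm hw.1, fun h => absurd h.symm hw.2⟩
    rcases eq_or_ne x b with rfl | hxb
    · rw [Equiv.swap_apply_right]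
      exact ⟨fun h => absurd h.symm hw.2, fun h => absurd h.symm hw.1⟩
    rw [Equiv.swap_apply_of_ne_of_ne hxa hxb]
  refine and_congr Iff.rfl (exists_congr fun e => exists_congr fun c => and_congr ?_ ?_)
  · exact key _ _ hu
  · exact key _ _ hv

/-- A transposition alters only edges at `a.1` and `b.1`, so `hausdorffDist_statisticSet_le` applies
with |W| ≤ 2; the distance from q is 1-Lipschitz for the Hausdorff distance. -/
theorem abs_infDist_configBounded_swap_le (hn : 0 < n) (r k : ℕ) (q : Statistic (k + 1))
    (σ : Fin m × Bool ≃ Fin n × Fin d) (a b : Fin n × Fin d) :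
    |Metric.infDist q ((configBounded hn (σ.trans (Equiv.swap a b))).Q r (k + 1)) -
      Metric.infDist q ((configBounded hn σ).Q r (k + 1))| ≤ 4 * (d + 1) ^ r / n := by
  have : Nonempty (Fin n) := ⟨⟨0, hn⟩⟩
  have h1 : Metric.hausdorffDist ((configBounded hn σ).Q r (k + 1))
      ((configBounded hn (σ.trans (Equiv.swap a b))).Q r (k + 1)) ≤ 4 * (d + 1) ^ r / n := by
    refine (hausdorffDist_statisticSet_le (V := Fin n) (W := {a.1, b.1})
      (ncard_neighborSet_configGraph_le σ)
      (ncard_neighborSet_configGraph_le (σ.trans (Equiv.swap a b)))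
      (fun u v hu hv => configGraph_adj_of_swap hu hv) r (k + 1)).trans ?_
    rw [Fintype.card_fin]
    have : (({a.1, b.1} : Set (Fin n)).ncard : ℝ) ≤ 2 := by
      have := Set.ncard_insert_le a.1 {b.1}
      rw [Set.ncard_singleton] at this
      exact_mod_cast this
    gcongr
    linarith
  have hfin : ∀ G G' : BoundedDegreeGraph d,
      Metric.hausdorffEDist (G.Q r (k + 1)) (G'.Q r (k + 1)) ≠ ⊤ := fun G G' =>
    Metric.hausdorffEDist_ne_top_of_nonempty_of_bounded (G.Q_nonempty r k) (G'.Q_nonempty r k)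
      (BoundedDegreeGraph.isBounded_statistic _) (BoundedDegreeGraph.isBounded_statistic _)
  have h2 := Metric.infDist_le_infDist_add_hausdorffDist (x := q)
    (hfin (configBounded hn σ) (configBounded hn (σ.trans (Equiv.swap a b))))
  have h3 := Metric.infDist_le_infDist_add_hausdorffDist (x := q)
    (hfin (configBounded hn (σ.trans (Equiv.swap a b))) (configBounded hn σ))
  rw [Metric.hausdorffDist_comm] at h3
  rw [abs_le]
  constructor <;> linarith

end Configuration

/-! ### Counting the configurations of a regular graph -/

section Fibers

variable {m n d : ℕ} {G : SimpleGraph (Fin n)}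

theorem exists_edge_enumeration [Fintype G.edgeSet] (hm : G.edgeFinset.card = m) :
    ∃ x : Fin m → Bool → Fin n, (∀ e b, G.Adj (x e b) (x e !b)) ∧
      (∀ e e' b b', x e b = x e' b' → x e (!b) = x e' (!b') → e = e' ∧ b = b') ∧
      ∀ u v, G.Adj u v → ∃ e b, x e b = u ∧ x e (!b) = v := by
  rw [SimpleGraph.edgeFinset_card] at hm
  let ε : Fin m ≃ G.edgeSet := (Fintype.equivFinOfCardEq hm).symm
  have hex : ∀ e : Fin m, ∃ p : Fin n × Fin n, s(p.1, p.2) = (ε e : Sym2 (Fin n)) := by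
    intro e
    induction (ε e : Sym2 (Fin n)) using Sym2.ind with
    | _ u v => exact ⟨(u, v), rfl⟩
  choose p hp using hex
  let x : Fin m → Bool → Fin n := fun e b => if b then (p e).1 else (p e).2
  have hx : ∀ e b, s(x e b, x e !b) = (ε e : Sym2 (Fin n)) := by
    intro e b
    rw [← hp e]
    cases b
    · exact Sym2.eq_swap
    · rfl
  have hadj : ∀ e b, G.Adj (x e b) (x e !b) := by
    intro e b
    rw [← SimpleGraph.mem_edgeSet, hx]
    exact (ε e).2
  refine ⟨x, hadj, ?_, ?_⟩
  · intro e e' b b' h1 h2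
    have hee : e = e' := by
      apply ε.injective
      apply Subtype.ext
      rw [← hx e b, ← hx e' b', h1, h2]
    subst hee
    refine ⟨rfl, ?_⟩
    by_contra hbb
    have : (!b) = b' := by revert hbb; cases b <;> cases b' <;> simp
    rw [← this] at h1
    exact (hadj e b).ne h1
  · intro u v huv
    obtain ⟨e, he⟩ := ε.surjective ⟨s(u, v), huv⟩
    have h1 := hx e true
    rw [he] at h1
    rcases Sym2.eq_iff.1 h1 with ⟨h2, h3⟩ | ⟨h2, h3⟩
    · exact ⟨e, true, h2, h3⟩
    · exact ⟨e, false, h3, h2⟩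

/-- Every regular graph comes from many configurations. -/
theorem card_configurations_ge (hmn : 2 * m = n * d) [DecidableRel G.Adj]
    (hG : G.IsRegularOfDegree d) :
    m.factorial * 2 ^ m * d.factorial ^ n ≤
      {σ : Fin m × Bool ≃ Fin n × Fin d | configGraph σ = G}.ncard := by
  classical
  have hm : G.edgeFinset.card = m := by
    have h1 := G.sum_degrees_eq_twice_card_edges
    simp only [hG.degree_eq, Finset.sum_const, Finset.card_univ, Fintype.card_fin,
      smul_eq_mul] at h1
    omega
  obtain ⟨x, hadj, hxinj, hxsurj⟩ := exists_edge_enumeration hm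
  -- A configuration of G arises from an order of the edges, an orientation of each edge, and at
  -- each vertex a bijection from its neighbours to its d half-edges.
  let P := Equiv.Perm (Fin m) × (Fin m → Bool) × (∀ v, G.neighborSet v ≃ Fin d)
  let T : P → Fin m × Bool → Fin m × Bool := fun p a => (p.1 a.1, xor a.2 (p.2.1 a.1))
  have hTinj : ∀ p, Function.Injective (T p) := by
    intro p a b h
    simp only [T, Prod.mk.injEq] at h
    have h1 := p.1.injective h.1
    rw [h1] at h
    exact Prod.ext h1 (Bool.xor_left_inj.1 h.2)
  have hTsurj : ∀ p, Function.Surjective (T p) := fun p => Finite.surjective_of_injective (hTinj p)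
  have hTnot : ∀ p e b, T p (e, !b) = ((T p (e, b)).1, !(T p (e, b)).2) := by
    intro p e b
    simp [T]
  let val : P → Fin m × Bool → Fin n × Fin d := fun p a =>
    (x (T p a).1 (T p a).2, p.2.2 _ ⟨x (T p a).1 (!(T p a).2), hadj _ _⟩)
  have hval : ∀ p, Function.Injective (val p) := by
    intro p a b h
    have key : ∀ (u u' : Fin n) (w : G.neighborSet u) (w' : G.neighborSet u'),
        u = u' → p.2.2 u w = p.2.2 u' w' → (w : Fin n) = w' := by
      rintro u _ w w' rfl h
      rw [(p.2.2 u).injective h]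
    have h1 := congrArg Prod.fst h
    have h2 := key _ _ _ _ h1 (congrArg Prod.snd h)
    obtain ⟨h3, h4⟩ := hxinj _ _ _ _ h1 h2
    exact hTinj p (Prod.ext h3 h4)
  have hcard : Fintype.card (Fin m × Bool) = Fintype.card (Fin n × Fin d) := by
    simp only [Fintype.card_prod, Fintype.card_fin, Fintype.card_bool]
    omega
  let Ψ : P → (Fin m × Bool ≃ Fin n × Fin d) := fun p =>
    Equiv.ofBijective (val p) ((Fintype.bijective_iff_injective_and_card _).2 ⟨hval p, hcard⟩)
  have hΨ : ∀ p, configGraph (Ψ p) = G := by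
    intro p
    ext u v
    constructor
    · rintro ⟨-, e, b, rfl, rfl⟩
      change G.Adj (x (T p (e, b)).1 (T p (e, b)).2) (x (T p (e, !b)).1 (T p (e, !b)).2)
      rw [hTnot]
      exact hadj _ _
    · intro huv
      obtain ⟨e, b, rfl, rfl⟩ := hxsurj u v huv
      obtain ⟨⟨e', b'⟩, h⟩ := hTsurj p (e, b)
      refine ⟨huv.ne, e', b', ?_, ?_⟩
      · change x (T p (e', b')).1 (T p (e', b')).2 = _
        rw [h]
      · change x (T p (e', !b')).1 (T p (e', !b')).2 = _
        rw [hTnot, h]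
  have hΨinj : Function.Injective Ψ := by
    intro p p' h
    have hv : ∀ a, val p a = val p' a := fun a => congrArg (fun σ => σ a) h
    -- The vertex components at the two ends recover the oriented edge; the half-edge components
    -- then recover the local bijections.
    have hT : ∀ a, T p a = T p' a := by
      rintro ⟨e, b⟩
      have h1 := congrArg Prod.fst (hv (e, b))
      have h2 := congrArg Prod.fst (hv (e, !b))
      simp only [val, hTnot] at h1 h2
      obtain ⟨h3, h4⟩ := hxinj _ _ _ _ h1 h2
      exact Prod.ext h3 h4
    refine Prod.ext ?_ (Prod.ext ?_ ?_)
    · ext e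
      exact congrArg (fun y : Fin m × Bool => (y.1 : ℕ)) (hT (e, true))
    · funext e
      have := congrArg Prod.snd (hT (e, true))
      simpa [T] using this
    · funext v
      refine Equiv.ext fun w => ?_
      obtain ⟨w, hw⟩ := w
      obtain ⟨e, b, rfl, rfl⟩ := hxsurj v w hw
      obtain ⟨a, ha⟩ := hTsurj p (e, b)
      have ha' : T p' a = (e, b) := by rw [← hT, ha]
      have key : ∀ (q : P) (y : Fin m × Bool), T q a = y →
          (val q a).2 = q.2.2 _ ⟨x y.1 (!y.2), hadj _ _⟩ := by
        rintro q _ rfl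
        rfl
      rw [← key p _ ha, ← key p' _ ha', hv a]
  have hle := Fintype.card_le_of_injective
    (fun p : P => (⟨Ψ p, hΨ p⟩ : {σ : Fin m × Bool ≃ Fin n × Fin d | configGraph σ = G}))
    fun p p' h => hΨinj (congrArg Subtype.val h)
  rw [← Nat.card_eq_fintype_card (α := {σ : Fin m × Bool ≃ Fin n × Fin d | configGraph σ = G}),
    Nat.card_coe_set_eq] at hle
  refine le_of_eq_of_le ?_ hle
  have hρ : ∀ v, Fintype.card (G.neighborSet v ≃ Fin d) = d.factorial := by
    intro v
    have hv : Fintype.card (G.neighborSet v) = d := by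
      rw [SimpleGraph.card_neighborSet_eq_degree, hG.degree_eq]
    rw [Fintype.card_equiv (Fintype.equivFinOfCardEq hv), hv]
  rw [Fintype.card_prod, Fintype.card_prod, Fintype.card_perm, Fintype.card_fin, Fintype.card_fun,
    Fintype.card_bool, Fintype.card_fin, Fintype.card_pi, Finset.prod_congr rfl fun v _ => hρ v,
    Finset.prod_const, Finset.card_univ, Fintype.card_fin, mul_assoc]

end Fibers

/-- The `d`-regular graphs on `V`. -/
def regularSet (d : ℕ) (V : Type*) : Set (SimpleGraph V) :=
  {G | ∀ v, (G.neighborSet v).ncard = d}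

theorem ncard_regularSet_congr (d : ℕ) {V W : Type*} (e : V ≃ W) :
    (regularSet d V).ncard = (regularSet d W).ncard := by
  refine Set.ncard_congr (fun G _ => G.comap e.symm) ?_ ?_ ?_
  · intro G hG v
    have : (G.comap e.symm).neighborSet v = e '' G.neighborSet (e.symm v) := by
      ext w
      rw [Equiv.image_eq_preimage_symm]
      rfl
    rw [this, Set.ncard_image_of_injective _ e.injective]
    exact hG _
  · intro G G' _ _ h
    ext u v
    have := congrArg (fun H => H.Adj (e u) (e v)) h
    simpa using this
  · intro G hG
    refine ⟨G.comap e, fun v => ?_, ?_⟩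
    · have : (G.comap e).neighborSet v = e.symm '' G.neighborSet (e v) := by
        ext w
        rw [Equiv.image_eq_preimage_symm]
        rfl
      rw [this, Set.ncard_image_of_injective _ e.symm.injective]
      exact hG _
    · ext u v
      simp

/-! ### From regular graphs on n vertices to regular graphs on n + 2 -/

section Insertion

variable {V : Type*}

/-- A family of `j` pairwise disjoint oriented edges. -/
def IsMatchingTuple (G : SimpleGraph V) {j : ℕ} (a : Fin j → Bool → V) : Prop :=
  (∀ i, G.Adj (a i false) (a i true)) ∧ Function.Injective fun p : Fin j × Bool => a p.1 p.2

theorem IsMatchingTuple.adj {G : SimpleGraph V} {j : ℕ} {a : Fin j → Bool → V}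
    (h : IsMatchingTuple G a) (i : Fin j) (c : Bool) : G.Adj (a i c) (a i !c) := by
  cases c
  · exact h.1 i
  · exact (h.1 i).symm

theorem IsMatchingTuple.eq {G : SimpleGraph V} {j : ℕ} {a : Fin j → Bool → V}
    (h : IsMatchingTuple G a) {i i' : Fin j} {c c' : Bool} (heq : a i c = a i' c') :
    i = i' ∧ c = c' := by
  have := @h.2 (i, c) (i', c') heq
  simpa using this

/-- Remove the edges of a matching, and join two new vertices to its end vertices. -/
def insertPair (G : SimpleGraph V) {j : ℕ} (a : Fin j → Bool → V) : SimpleGraph (V ⊕ Bool) where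
  Adj x y := match x, y with
    | Sum.inl u, Sum.inl v => G.Adj u v ∧ ¬ ∃ i c, a i c = u ∧ a i (!c) = v
    | Sum.inl u, Sum.inr c => ∃ i, a i c = u
    | Sum.inr c, Sum.inl u => ∃ i, a i c = u
    | Sum.inr _, Sum.inr _ => False
  symm := ⟨by
    rintro (u | c) (v | c') h
    · refine ⟨h.1.symm, fun ⟨i, c, h1, h2⟩ => h.2 ⟨i, !c, h2, by rwa [Bool.not_not]⟩⟩
    · exact h
    · exact h
    · exact h⟩
  loopless := ⟨by
    rintro (u | c) h
    · exact h.1.ne rfl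
    · exact h⟩

/-- Each end of the matching trades its partner for one new vertex, and each new vertex receives d
distinct ends. -/
theorem insertPair_mem_regularSet [Finite V] {d : ℕ} {G : SimpleGraph V} (hG : G ∈ regularSet d V)
    {a : Fin d → Bool → V} (ha : IsMatchingTuple G a) :
    insertPair G a ∈ regularSet d (V ⊕ Bool) := by
  rintro (u | c)
  · by_cases hu : ∃ i c, a i c = u
    · obtain ⟨i, c, rfl⟩ := hu
      have hset : (insertPair G a).neighborSet (Sum.inl (a i c)) =
          insert (Sum.inr c) (Sum.inl '' (G.neighborSet (a i c) \ {a i !c})) := by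
        ext (v | c')
        · change (G.Adj (a i c) v ∧ ¬ ∃ i' c', a i' c' = a i c ∧ a i' (!c') = v) ↔ _
          simp only [Set.mem_insert_iff, reduceCtorEq, Set.mem_image, Sum.inl.injEq, false_or,
            exists_eq_right, Set.mem_sdiff, SimpleGraph.mem_neighborSet, Set.mem_singleton_iff]
          refine and_congr_right fun _ => not_congr ⟨?_, ?_⟩
          · rintro ⟨i', c', h1, rfl⟩
            obtain ⟨rfl, rfl⟩ := ha.eq h1
            rfl
          · rintro rfl
            exact ⟨i, c, rfl, rfl⟩
        · change (∃ i', a i' c' = a i c) ↔ _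
          simp only [Set.mem_insert_iff, Sum.inr.injEq, Set.mem_image, reduceCtorEq, and_false,
            exists_false, or_false]
          constructor
          · rintro ⟨i', h⟩
            exact (ha.eq h).2
          · rintro rfl
            exact ⟨i, rfl⟩
      rw [hset, Set.ncard_insert_of_notMem (by simp) (Set.toFinite _),
        Set.ncard_image_of_injective _ Sum.inl_injective,
        Set.ncard_sdiff_singleton_add_one (show a i (!c) ∈ G.neighborSet (a i c) from ha.adj i c)
          (Set.toFinite _)]
      exact hG _
    · have hset : (insertPair G a).neighborSet (Sum.inl u) = Sum.inl '' G.neighborSet u := by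
        ext (v | c')
        · change (G.Adj u v ∧ ¬ ∃ i' c', a i' c' = u ∧ a i' (!c') = v) ↔ _
          simp only [Set.mem_image, Sum.inl.injEq, exists_eq_right, SimpleGraph.mem_neighborSet]
          exact and_iff_left fun ⟨i', c', h, _⟩ => hu ⟨i', c', h⟩
        · change (∃ i', a i' c' = u) ↔ _
          simp only [Set.mem_image, reduceCtorEq, and_false, exists_false, iff_false]
          exact fun ⟨i', h⟩ => hu ⟨i', c', h⟩
      rw [hset, Set.ncard_image_of_injective _ Sum.inl_injective]
      exact hG u
  · have hset : (insertPair G a).neighborSet (Sum.inr c) =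
        (fun i => Sum.inl (a i c)) '' Set.univ := by
      ext (v | c')
      · change (∃ i, a i c = v) ↔ _
        simp
      · change False ↔ _
        simp
    rw [hset, Set.ncard_image_of_injective, Set.ncard_univ, Nat.card_fin]
    intro i i' h
    exact (ha.eq (Sum.inl_injective h)).1

/-- The insertion of two vertices determines the original graph, given the matching. -/
theorem eq_of_insertPair_eq {j : ℕ} {G G' : SimpleGraph V} {a : Fin j → Bool → V}
    (ha : IsMatchingTuple G a) (ha' : IsMatchingTuple G' a)
    (h : insertPair G a = insertPair G' a) : G = G' := by
  have key : ∀ {H : SimpleGraph V}, IsMatchingTuple H a → ∀ u v, H.Adj u v ↔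
      (insertPair H a).Adj (Sum.inl u) (Sum.inl v) ∨ ∃ i c, a i c = u ∧ a i (!c) = v := by
    intro H hH u v
    change _ ↔ (H.Adj u v ∧ ¬ ∃ i c, a i c = u ∧ a i (!c) = v) ∨ _
    by_cases hex : ∃ i c, a i c = u ∧ a i (!c) = v
    · simp only [hex, not_true_eq_false, and_false, or_true, iff_true]
      obtain ⟨i, c, rfl, rfl⟩ := hex
      exact hH.adj i c
    · simp only [hex, not_false_eq_true, and_true, or_false]
  ext u v
  rw [key ha, key ha', h]

/-- The new graph, with the order of the matched ends around each new vertex, determines the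
matching and then, by `eq_of_insertPair_eq`, the old graph. The two orders can be chosen in d!²
ways. -/
theorem sum_ncard_matchingTuples_le [Finite V] (d : ℕ) :
    Nat.card {p : SimpleGraph V × (Fin d → Bool → V) // p.1 ∈ regularSet d V ∧
      IsMatchingTuple p.1 p.2} ≤ (regularSet d (V ⊕ Bool)).ncard * d.factorial ^ 2 := by
  classical
  have := Fintype.ofFinite V
  let T := Σ H : regularSet d (V ⊕ Bool), ∀ c : Bool, Fin d ↪ H.1.neighborSet (Sum.inr c)
  let φ : {p : SimpleGraph V × (Fin d → Bool → V) // p.1 ∈ regularSet d V ∧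
      IsMatchingTuple p.1 p.2} → T := fun p =>
    ⟨⟨insertPair p.1.1 p.1.2, insertPair_mem_regularSet p.2.1 p.2.2⟩, fun c =>
      ⟨fun i => ⟨Sum.inl (p.1.2 i c), ⟨i, rfl⟩⟩, fun i i' h =>
        (p.2.2.eq (Sum.inl_injective (congrArg Subtype.val h))).1⟩⟩
  let val : T → SimpleGraph (V ⊕ Bool) × (Bool → Fin d → V ⊕ Bool) := fun t =>
    (t.1.1, fun c i => t.2 c i)
  have hφ : Function.Injective φ := by
    rintro ⟨⟨G, a⟩, hG, ha⟩ ⟨⟨G', a'⟩, hG', ha'⟩ h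
    have h' := congrArg val h
    have h1 : insertPair G a = insertPair G' a' := congrArg Prod.fst h'
    have h2 : a = a' := by
      funext i c
      exact Sum.inl_injective (congrFun (congrFun (congrArg Prod.snd h') c) i)
    subst h2
    have h3 := eq_of_insertPair_eq ha ha' h1
    subst h3
    rfl
  refine (Nat.card_le_card_of_injective φ hφ).trans_eq ?_
  rw [Nat.card_sigma]
  have hcard : ∀ H : regularSet d (V ⊕ Bool),
      Nat.card (∀ c : Bool, Fin d ↪ H.1.neighborSet (Sum.inr c)) = d.factorial ^ 2 := by
    intro H
    have hc : ∀ c : Bool, Fintype.card (Fin d ↪ H.1.neighborSet (Sum.inr c)) = d.factorial := by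
      intro c
      have h1 : Fintype.card (H.1.neighborSet (Sum.inr c)) = d := by
        rw [← Nat.card_eq_fintype_card, Nat.card_coe_set_eq]
        exact H.2 _
      rw [Fintype.card_embedding_eq, h1, Fintype.card_fin, Nat.descFactorial_self]
    rw [Nat.card_eq_fintype_card, Fintype.card_pi, Finset.prod_congr rfl fun c _ => hc c,
      Finset.prod_const, Finset.card_univ, Fintype.card_bool]
  rw [Finset.sum_congr rfl fun H _ => hcard H, Finset.sum_const, Finset.card_univ,
    smul_eq_mul, ← Nat.card_eq_fintype_card, Nat.card_coe_set_eq]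

/-- There are |V|d oriented edges, and at most |U|d of them start in U and at most |U|d end in U. -/
theorem ncard_darts_ge [Finite V] {d : ℕ} {G : SimpleGraph V} (hG : G ∈ regularSet d V)
    (U : Set V) : Nat.card V * d - 2 * (U.ncard * d) ≤
      {p : Bool → V | G.Adj (p false) (p true) ∧ ∀ c, p c ∉ U}.ncard := by
  classical
  have := Fintype.ofFinite V
  let E : Set (Bool → V) := {p | G.Adj (p false) (p true)}
  have hE : E.ncard = Nat.card V * d := by
    let e : E ≃ Σ u, G.neighborSet u :=
      { toFun := fun p => ⟨p.1 false, p.1 true, p.2⟩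
        invFun := fun q => ⟨fun c => if c then q.2.1 else q.1, q.2.2⟩
        left_inv := fun p => by
          refine Subtype.ext (funext fun c => ?_)
          cases c <;> rfl
        right_inv := fun q => rfl }
    rw [← Nat.card_coe_set_eq, Nat.card_congr e, Nat.card_sigma]
    have : ∀ u, Nat.card (G.neighborSet u) = d := fun u => by
      rw [Nat.card_coe_set_eq]
      exact hG u
    rw [Finset.sum_congr rfl fun u _ => this u, Finset.sum_const, Finset.card_univ, smul_eq_mul,
      Nat.card_eq_fintype_card]
  have hbad : ∀ c, {p ∈ E | p c ∈ U}.ncard ≤ U.ncard * d := by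
    intro c
    have hsub : {p ∈ E | p c ∈ U} ⊆ ⋃ u ∈ U.toFinset,
        (fun v (c' : Bool) => if c' = c then u else v) '' G.neighborSet u := by
      rintro p ⟨hp, hU⟩
      simp only [Set.mem_iUnion]
      refine ⟨p c, by simpa using hU, p !c, ?_, ?_⟩
      · cases c
        · exact hp
        · exact hp.symm
      · funext c'
        cases c <;> cases c' <;> rfl
    refine (Set.ncard_le_ncard hsub (Set.toFinite _)).trans
      ((Finset.set_ncard_biUnion_le _ _).trans ?_)
    rw [Set.ncard_eq_toFinset_card' U, ← smul_eq_mul]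
    exact Finset.sum_le_card_nsmul _ _ _ fun u _ =>
      (Set.ncard_image_le (Set.toFinite _)).trans (hG u).le
  have hsub : E ⊆ {p : Bool → V | G.Adj (p false) (p true) ∧ ∀ c, p c ∉ U} ∪
      ({p ∈ E | p false ∈ U} ∪ {p ∈ E | p true ∈ U}) := by
    intro p hp
    by_cases h0 : p false ∈ U
    · exact Or.inr (Or.inl ⟨hp, h0⟩)
    · by_cases h1 : p true ∈ U
      · exact Or.inr (Or.inr ⟨hp, h1⟩)
      · exact Or.inl ⟨hp, fun c => by cases c <;> assumption⟩
  have h1 := (Set.ncard_le_ncard hsub (Set.toFinite _)).trans (Set.ncard_union_le _ _)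
  have h2 := Set.ncard_union_le {p ∈ E | p false ∈ U} {p ∈ E | p true ∈ U}
  have h3 := hbad false
  have h4 := hbad true
  omega

/-- The oriented edges are chosen one at a time: at most 2d vertices are occupied, which forbids at
most 2 · 2d · d = 4d² choices. -/
theorem ncard_matchingTuples_ge [Finite V] {d : ℕ} {G : SimpleGraph V} (hG : G ∈ regularSet d V)
    {j : ℕ} (hj : j ≤ d) : (Nat.card V * d - 4 * d ^ 2) ^ j ≤
      {a : Fin j → Bool → V | IsMatchingTuple G a}.ncard := by
  classical
  have := Fintype.ofFinite V
  induction j with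
  | zero =>
    rw [pow_zero]
    refine Nat.one_le_iff_ne_zero.2 (Set.ncard_ne_zero_of_mem (a := fun i _ => i.elim0) ?_)
    exact ⟨fun i => i.elim0, fun p => p.1.elim0⟩
  | succ j ih =>
    let T := Σ a : {a : Fin j → Bool → V | IsMatchingTuple G a},
      {p : Bool → V | G.Adj (p false) (p true) ∧
        ∀ c, p c ∉ Set.range fun q : Fin j × Bool => a.1 q.1 q.2}
    let φ : T → {a : Fin (j + 1) → Bool → V | IsMatchingTuple G a} := fun t =>
      ⟨Fin.cons t.2.1 t.1.1, by
        refine ⟨fun i => ?_, ?_⟩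
        · refine Fin.cases ?_ (fun i => ?_) i
          · exact t.2.2.1
          · exact t.1.2.1 i
        · rintro ⟨i, c⟩ ⟨i', c'⟩ h
          revert h
          refine Fin.cases ?_ (fun i => ?_) i <;> refine Fin.cases ?_ (fun i' => ?_) i'
          · intro h
            have hne : ∀ c c', t.2.1 c = t.2.1 c' → c = c' := by
              have := t.2.2.1.ne
              intro c c' h
              cases c <;> cases c' <;> first | rfl | exact absurd h this | exact absurd h.symm this
            simp only [Fin.cons_zero] at h
            rw [hne _ _ h]
          · intro h
            exact absurd ⟨(i', c'), h.symm⟩ (t.2.2.2 c)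
          · intro h
            exact absurd ⟨(i, c), h⟩ (t.2.2.2 c')
          · intro h
            have h' : t.1.1 i c = t.1.1 i' c' := h
            obtain ⟨rfl, rfl⟩ := t.1.2.eq h'
            rfl⟩
    have hφ : Function.Injective φ := by
      rintro ⟨⟨a, ha⟩, p, hp⟩ ⟨⟨a', ha'⟩, p', hp'⟩ h
      have h' : (Fin.cons p a : Fin (j + 1) → Bool → V) = Fin.cons p' a' := congrArg Subtype.val h
      obtain ⟨rfl, rfl⟩ := Fin.cons_injective2 h'
      rfl
    have hcard := Nat.card_le_card_of_injective φ hφ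
    rw [Nat.card_sigma, Nat.card_coe_set_eq] at hcard
    refine le_trans ?_ hcard
    have hterm : ∀ a : {a : Fin j → Bool → V | IsMatchingTuple G a},
        Nat.card V * d - 4 * d ^ 2 ≤ Nat.card {p : Bool → V | G.Adj (p false) (p true) ∧
          ∀ c, p c ∉ Set.range fun q : Fin j × Bool => a.1 q.1 q.2} := by
      intro a
      rw [Nat.card_coe_set_eq]
      refine le_trans ?_ (ncard_darts_ge hG _)
      have hU : (Set.range fun q : Fin j × Bool => a.1 q.1 q.2).ncard ≤ 2 * d := by
        rw [← Set.image_univ]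
        refine (Set.ncard_image_le (Set.toFinite _)).trans ?_
        rw [Set.ncard_univ, Nat.card_prod, Nat.card_fin, Nat.card_eq_fintype_card,
          Fintype.card_bool]
        omega
      have := Nat.mul_le_mul_right d hU
      have h2 : 2 * d * d = 2 * d ^ 2 := by ring
      omega
    calc (Nat.card V * d - 4 * d ^ 2) ^ (j + 1)
        = (Nat.card V * d - 4 * d ^ 2) ^ j * (Nat.card V * d - 4 * d ^ 2) := pow_succ _ _
      _ ≤ {a : Fin j → Bool → V | IsMatchingTuple G a}.ncard *
          (Nat.card V * d - 4 * d ^ 2) := Nat.mul_le_mul_right _ (ih (by omega))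
      _ ≤ _ := by
        rw [← Nat.card_coe_set_eq, Nat.card_eq_fintype_card, ← Finset.card_univ, ← smul_eq_mul]
        exact Finset.card_nsmul_le_sum _ _ _ fun a _ => hterm a

/-- The number of regular graphs grows with the number of vertices at least like the number of
configurations, up to a factor close to `1`. -/
theorem ncard_regularSet_mul_le (d n : ℕ) :
    (regularSet d (Fin n)).ncard * (n * d - 4 * d ^ 2) ^ d ≤
      (regularSet d (Fin (n + 2))).ncard * d.factorial ^ 2 := by
  classical
  have e : Fin n ⊕ Bool ≃ Fin (n + 2) := Fintype.equivFinOfCardEq (by simp)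
  rw [← ncard_regularSet_congr d e]
  refine le_trans ?_ (sum_ncard_matchingTuples_le (V := Fin n) d)
  let T := Σ G : regularSet d (Fin n), {a : Fin d → Bool → Fin n | IsMatchingTuple G.1 a}
  let e' : {p : SimpleGraph (Fin n) × (Fin d → Bool → Fin n) // p.1 ∈ regularSet d (Fin n) ∧
      IsMatchingTuple p.1 p.2} ≃ T :=
    { toFun := fun p => ⟨⟨p.1.1, p.2.1⟩, p.1.2, p.2.2⟩
      invFun := fun t => ⟨(t.1.1, t.2.1), t.1.2, t.2.2⟩
      left_inv := fun _ => rfl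
      right_inv := fun _ => rfl }
  rw [Nat.card_congr e', Nat.card_sigma, ← Nat.card_coe_set_eq (regularSet d (Fin n)),
    Nat.card_eq_fintype_card, ← Finset.card_univ, ← smul_eq_mul]
  refine Finset.card_nsmul_le_sum _ _ _ fun G _ => ?_
  have := ncard_matchingTuples_ge G.2 le_rfl
  rwa [Nat.card_fin] at this

end Insertion

/-! ### Subexponential decay of the probability of simplicity -/

/-- A lower bound for the number of configurations with a given regular graph. -/
def configWeight (d n : ℕ) : ℕ := (n * d / 2).factorial * 2 ^ (n * d / 2) * d.factorial ^ n

theorem configWeight_pos (d n : ℕ) : 0 < configWeight d n := by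
  unfold configWeight
  positivity

/-- A lower bound for the probability that a random configuration is regular. -/
def regularRatio (d n : ℕ) : ℝ :=
  configWeight d n * (regularSet d (Fin n)).ncard / (n * d).factorial

/-- Raising j by one multiplies the left by an even factor, which equals 2(m+j+1) and is matched
exactly on the right, and by an odd factor bounded by B. -/
theorem factorial_mul_factorial_le {m B : ℕ} (j : ℕ) (hB : 2 * m + 2 * j ≤ B) :
    (2 * m + 2 * j).factorial * m.factorial ≤
      (2 * m).factorial * ((m + j).factorial * 2 ^ j * B ^ j) := by
  induction j with
  | zero => simp
  | succ j ih =>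
    have ih := ih (by omega)
    have h1 : (2 * m + 2 * (j + 1)).factorial =
        (2 * m + 2 * j + 2) * ((2 * m + 2 * j + 1) * (2 * m + 2 * j).factorial) := by
      rw [show 2 * m + 2 * (j + 1) = 2 * m + 2 * j + 1 + 1 by ring, Nat.factorial_succ,
        Nat.factorial_succ]
    have h2 : (m + (j + 1)).factorial = (m + j + 1) * (m + j).factorial := Nat.factorial_succ _
    rw [h1, h2, pow_succ, pow_succ]
    calc (2 * m + 2 * j + 2) * ((2 * m + 2 * j + 1) * (2 * m + 2 * j).factorial) * m.factorial
        = (2 * m + 2 * j + 2) * (2 * m + 2 * j + 1) * ((2 * m + 2 * j).factorial * m.factorial) := by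
          ring
      _ ≤ (2 * m + 2 * j + 2) * B *
          ((2 * m).factorial * ((m + j).factorial * 2 ^ j * B ^ j)) := by
        gcongr
        omega
      _ = _ := by ring

/-- The insertion bound controls the growth of the number of regular graphs, and the factorial bound
that of m! 2^m against (2m)!; the powers of d! cancel. -/
theorem regularRatio_add_two_ge {d n : ℕ} (hd : 0 < d) (hn : Even (n * d)) :
    regularRatio d n * ((n * d - 4 * d ^ 2 : ℕ) / (n * d + 2 * d : ℕ) : ℝ) ^ d ≤
      regularRatio d (n + 2) := by
  obtain ⟨m, hm⟩ := hn
  have hm2 : n * d = 2 * m := by omega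
  have hdiv : n * d / 2 = m := by omega
  have hnd : (n + 2) * d = n * d + 2 * d := by ring
  have hdiv2 : (n + 2) * d / 2 = m + d := by omega
  have hB : 0 < n * d + 2 * d := by omega
  have h1 := ncard_regularSet_mul_le d n
  have h2 := factorial_mul_factorial_le (m := m) d (le_refl (2 * m + 2 * d))
  rw [← hm2] at h2
  set R := (regularSet d (Fin n)).ncard
  set R' := (regularSet d (Fin (n + 2))).ncard
  set A := n * d - 4 * d ^ 2
  set B := n * d + 2 * d
  have key : configWeight d n * R * A ^ d * B.factorial ≤
      configWeight d (n + 2) * R' * (n * d).factorial * B ^ d := by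
    unfold configWeight
    rw [hdiv, hdiv2]
    calc m.factorial * 2 ^ m * d.factorial ^ n * R * A ^ d * B.factorial
        = (B.factorial * m.factorial) * (R * A ^ d) * (2 ^ m * d.factorial ^ n) := by ring
      _ ≤ ((n * d).factorial * ((m + d).factorial * 2 ^ d * B ^ d)) * (R' * d.factorial ^ 2) *
          (2 ^ m * d.factorial ^ n) := by gcongr
      _ = _ := by ring
  unfold regularRatio
  rw [hnd, div_pow, div_mul_div_comm, div_le_div_iff₀ (by positivity) (by positivity)]
  have key' : ((configWeight d n * R * A ^ d * B.factorial : ℕ) : ℝ) ≤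
      (configWeight d (n + 2) * R' * (n * d).factorial * B ^ d : ℕ) := by exact_mod_cast key
  push_cast at key'
  calc _ ≤ _ := key'
    _ = _ := by ring

theorem even_of_mem_regularSet {d n : ℕ} {G : SimpleGraph (Fin n)}
    (hG : G ∈ regularSet d (Fin n)) : Even (n * d) := by
  classical
  have h := G.sum_degrees_eq_twice_card_edges
  have hdeg : ∀ v, G.degree v = d := fun v => by
    rw [← SimpleGraph.card_neighborSet_eq_degree, ← Nat.card_eq_fintype_card, Nat.card_coe_set_eq]
    exact hG v
  simp only [hdeg, Finset.sum_const, Finset.card_univ, Fintype.card_fin, smul_eq_mul] at h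
  exact ⟨_, h.trans (two_mul _)⟩

theorem exists_regularRatio_add_two_ge {d : ℕ} (hd : 0 < d) {ρ : ℝ} (hρ : ρ < 1) :
    ∃ N, ∀ n ≥ N, Even (n * d) → regularRatio d n * ρ ≤ regularRatio d (n + 2) := by
  have hlim : Tendsto (fun n : ℕ => ((n * d - 4 * d ^ 2 : ℕ) / (n * d + 2 * d : ℕ) : ℝ) ^ d) atTop
      (𝓝 1) := by
    -- For n ≥ 4d the truncated subtraction is genuine, and the quotient equals 1 - (4d+2)/(n+2).
    have h1 : Tendsto (fun n : ℕ => 1 - ((4 * d + 2 : ℕ) : ℝ) / ((n + 2 : ℕ) : ℝ)) atTop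
        (𝓝 (1 - 0)) :=
      tendsto_const_nhds.sub (tendsto_const_nhds.div_atTop
        (tendsto_natCast_atTop_atTop.comp (tendsto_add_atTop_nat 2)))
    have h2 := h1.pow d
    rw [sub_zero, one_pow] at h2
    refine h2.congr' ?_
    filter_upwards [eventually_ge_atTop (4 * d)] with n hn
    congr 1
    have h3 : 4 * d ^ 2 ≤ n * d := by
      calc 4 * d ^ 2 = 4 * d * d := by ring
        _ ≤ n * d := Nat.mul_le_mul_right d hn
    rw [Nat.cast_sub h3]
    push_cast
    have : (d : ℝ) ≠ 0 := by exact_mod_cast hd.ne'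
    field_simp
    ring
  obtain ⟨N, hN⟩ := eventually_atTop.1 (hlim.eventually_const_le hρ)
  refine ⟨N, fun n hn hev => le_trans ?_ (regularRatio_add_two_ge hd hev)⟩
  refine mul_le_mul_of_nonneg_left (hN n hn) ?_
  unfold regularRatio
  positivity

/-- The probability that a random configuration is regular decays subexponentially. -/
theorem exists_regularRatio_ge {d : ℕ} (hd : 0 < d) {ρ : ℝ} (hρ0 : 0 < ρ) (hρ : ρ < 1) :
    ∃ c > 0, ∃ N, ∀ n ≥ N, (regularSet d (Fin n)).Nonempty → c * ρ ^ n ≤ regularRatio d n := by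
  obtain ⟨N₀, hN₀⟩ := exists_regularRatio_add_two_ge hd hρ
  -- The recursion moves in steps of two, so each parity class needs its own starting size; a class
  -- without large regular graphs holds vacuously.
  have hclass : ∀ q : ℕ, ∃ c > 0, ∃ N, ∀ n ≥ N, n % 2 = q → (regularSet d (Fin n)).Nonempty →
      c * ρ ^ n ≤ regularRatio d n := by
    intro q
    by_cases h : ∃ b ≥ N₀, b % 2 = q ∧ (regularSet d (Fin b)).Nonempty
    · obtain ⟨b, hb, hbq, G, hG⟩ := h
      have hpos : 0 < regularRatio d b := by
        unfold regularRatio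
        have h1 : 0 < (regularSet d (Fin b)).ncard :=
          (Set.ncard_pos (Set.toFinite _)).2 ⟨G, hG⟩
        have h2 := configWeight_pos d b
        positivity
      refine ⟨regularRatio d b, hpos, b, fun n hn hnq hne => ?_⟩
      obtain ⟨k, rfl⟩ : ∃ k, n = b + 2 * k := ⟨(n - b) / 2, by omega⟩
      have hk : regularRatio d b * ρ ^ k ≤ regularRatio d (b + 2 * k) := by
        clear hn hnq hne
        induction k with
        | zero => simp
        | succ k ih =>
          have hev : Even ((b + 2 * k) * d) := by
            rw [add_mul]
            exact (even_of_mem_regularSet hG).add (by rw [mul_assoc]; exact even_two_mul _)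
          calc regularRatio d b * ρ ^ (k + 1) = regularRatio d b * ρ ^ k * ρ := by ring
            _ ≤ regularRatio d (b + 2 * k) * ρ := by gcongr
            _ ≤ regularRatio d (b + 2 * k + 2) := hN₀ _ (by omega) hev
      refine le_trans ?_ hk
      exact mul_le_mul_of_nonneg_left (pow_le_pow_of_le_one hρ0.le hρ.le (by omega)) hpos.le
    · refine ⟨1, one_pos, N₀, fun n hn hnq hne => absurd ⟨n, hn, hnq, hne⟩ h⟩
  obtain ⟨c₀, hc₀, M₀, h₀⟩ := hclass 0
  obtain ⟨c₁, hc₁, M₁, h₁⟩ := hclass 1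
  refine ⟨min c₀ c₁, lt_min hc₀ hc₁, max M₀ M₁, fun n hn hne => ?_⟩
  rcases Nat.mod_two_eq_zero_or_one n with h | h
  · refine le_trans ?_ (h₀ n (le_of_max_le_left hn) h hne)
    gcongr
    exact min_le_left _ _
  · refine le_trans ?_ (h₁ n (le_of_max_le_right hn) h hne)
    gcongr
    exact min_le_right _ _

/-! ### Concentration of uniform random regular graphs -/

namespace RegularGraph

variable {d n : ℕ}

theorem mem_regularSet (G : RegularGraph d n) : G.1 ∈ regularSet d (Fin n) := by
  classical
  intro v
  rw [← Nat.card_coe_set_eq, Nat.card_eq_fintype_card, SimpleGraph.card_neighborSet_eq_degree]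
  convert G.2.2.degree_eq v

theorem card_eq_ncard_regularSet (hn : 0 < n) :
    Nat.card (RegularGraph d n) = (regularSet d (Fin n)).ncard := by
  classical
  rw [← Nat.card_coe_set_eq]
  refine Nat.card_congr (Equiv.subtypeEquivRight fun G => ⟨fun h => mem_regularSet ⟨G, h⟩,
    fun h => ⟨hn, fun v => ?_⟩⟩)
  rw [← SimpleGraph.card_neighborSet_eq_degree, ← Nat.card_eq_fintype_card, Nat.card_coe_set_eq]
  exact h v

theorem configBounded_eq_toBounded {m : ℕ} (hn : 0 < n) {σ : Fin m × Bool ≃ Fin n × Fin d}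
    {G : RegularGraph d n} (h : configGraph σ = G.1) : configBounded hn σ = G.toBounded := by
  obtain ⟨G, hG⟩ := G
  subst h
  rfl

/-- The fibres over distinct graphs are disjoint, and `card_configurations_ge` bounds each from
below. -/
theorem card_mul_configWeight_le {m : ℕ} (hmn : 2 * m = n * d) (B : Set (RegularGraph d n)) :
    B.ncard * configWeight d n ≤
      {σ : Fin m × Bool ≃ Fin n × Fin d | ∃ G ∈ B, configGraph σ = G.1}.ncard := by
  classical
  let T := Σ G : B, {σ : Fin m × Bool ≃ Fin n × Fin d | configGraph σ = G.1.1}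
  let φ : T → {σ : Fin m × Bool ≃ Fin n × Fin d | ∃ G ∈ B, configGraph σ = G.1} := fun t =>
    ⟨t.2.1, t.1.1, t.1.2, t.2.2⟩
  have hφ : Function.Injective φ := by
    rintro ⟨⟨G, hG⟩, σ, hσ⟩ ⟨⟨G', hG'⟩, σ', hσ'⟩ h
    have h1 : σ = σ' := congrArg Subtype.val h
    subst h1
    have h2 : G = G' := Subtype.ext (Eq.trans (Eq.symm hσ) hσ')
    subst h2
    rfl
  have := Fintype.ofFinite B
  have hcard := Nat.card_le_card_of_injective φ hφ
  rw [Nat.card_sigma, Nat.card_coe_set_eq] at hcard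
  refine le_trans ?_ hcard
  rw [← Nat.card_coe_set_eq, Nat.card_eq_fintype_card, ← Finset.card_univ, ← smul_eq_mul]
  refine Finset.card_nsmul_le_sum _ _ _ fun G _ => ?_
  have hdiv : n * d / 2 = m := by omega
  rw [Nat.card_coe_set_eq, configWeight, hdiv]
  exact card_configurations_ge hmn (G := G.1.1) G.1.2.2

theorem uniformRegular_real [Nonempty (RegularGraph d n)] (B : Set (RegularGraph d n)) :
    (uniformRegular d n).real B = B.ncard / Nat.card (RegularGraph d n) := by
  have := Fintype.ofFinite (RegularGraph d n)
  rw [uniformRegular, uniformOn_univ_real, Nat.card_eq_fintype_card]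

/-- Concentration for uniform random regular graphs. -/
theorem exists_real_abs_infDist_sub_ge_le (hd : 0 < d) [Nonempty (RegularGraph d n)] {r k K : ℕ}
    (hr : r ≤ K) (q : Statistic (k + 1)) {t : ℝ} (ht : 0 ≤ t) :
    ∃ μ : ℝ, (uniformRegular d n).real
      {G | t ≤ |Metric.infDist q (G.toBounded.Q r (k + 1)) - μ|} ≤
        2 * Real.exp (-(t ^ 2 / (128 * (d + 1) ^ (2 * K) * d) * n)) / regularRatio d n := by
  classical
  obtain ⟨G₀⟩ := ‹Nonempty (RegularGraph d n)›
  have : Nonempty (RegularGraph d n) := ⟨G₀⟩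
  have hn : 0 < n := G₀.2.1
  obtain ⟨m, hm⟩ := even_of_mem_regularSet G₀.mem_regularSet
  have hmn : 2 * m = n * d := by omega
  have hn' : (0 : ℝ) < n := by exact_mod_cast hn
  have hd' : (0 : ℝ) < d := by exact_mod_cast hd
  let F : (Fin m × Bool ≃ Fin n × Fin d) → ℝ := fun σ =>
    Metric.infDist q ((configBounded hn σ).Q r (k + 1))
  -- Using K instead of r makes the rate the same for all radii up to K.
  let c : ℝ := 4 * (d + 1) ^ K / n
  have hc : 0 < c := by positivity
  have hF : ∀ σ a b, |F (σ.trans (Equiv.swap a b)) - F σ| ≤ c := by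
    intro σ a b
    refine (abs_infDist_configBounded_swap_le hn r k q σ a b).trans ?_
    simp only [c]
    gcongr
    linarith
  obtain ⟨μ, hμ⟩ := exists_card_equiv_abs_sub_ge_le (N := n * d) (Nat.mul_pos hn hd)
    (by simp only [Fintype.card_prod, Fintype.card_fin, Fintype.card_bool]; omega)
    (by simp only [Fintype.card_prod, Fintype.card_fin]) hc F hF
  refine ⟨μ, ?_⟩
  set B := {G : RegularGraph d n | t ≤ |Metric.infDist q (G.toBounded.Q r (k + 1)) - μ|}
  have h1 : (B.ncard * configWeight d n : ℝ) ≤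
      2 * (n * d).factorial * Real.exp (-(t ^ 2 / (8 * c ^ 2 * (n * d : ℕ)))) := by
    refine le_trans ?_ (hμ t ht)
    refine le_trans (b := ({σ : Fin m × Bool ≃ Fin n × Fin d |
      ∃ G ∈ B, configGraph σ = G.1}.ncard : ℝ)) (by exact_mod_cast card_mul_configWeight_le hmn B) ?_
    refine Nat.cast_le.2 (Set.ncard_le_ncard ?_ (Set.toFinite _))
    rintro σ ⟨G, hG, hσ⟩
    change t ≤ |Metric.infDist q ((configBounded hn σ).Q r (k + 1)) - μ|
    rw [configBounded_eq_toBounded hn hσ]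
    exact hG
  have hexp : t ^ 2 / (8 * c ^ 2 * (n * d : ℕ)) = t ^ 2 / (128 * (d + 1) ^ (2 * K) * d) * n := by
    simp only [c]
    push_cast
    rw [pow_mul, ← pow_mul, mul_comm 2 K, pow_mul]
    field_simp
    ring
  rw [hexp] at h1
  rw [uniformRegular_real, card_eq_ncard_regularSet hn, regularRatio]
  have hR : 0 < (regularSet d (Fin n)).ncard :=
    (Set.ncard_pos (Set.toFinite _)).2 ⟨_, G₀.mem_regularSet⟩
  have hw := configWeight_pos d n
  have hR' : (0 : ℝ) < (regularSet d (Fin n)).ncard := by exact_mod_cast hR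
  have hw' : (0 : ℝ) < configWeight d n := by exact_mod_cast hw
  rw [div_div_eq_mul_div, div_le_div_iff₀ hR' (by positivity)]
  calc (B.ncard : ℝ) * (configWeight d n * (regularSet d (Fin n)).ncard)
      = B.ncard * configWeight d n * (regularSet d (Fin n)).ncard := by ring
    _ ≤ 2 * (n * d).factorial * Real.exp (-(t ^ 2 / (128 * (d + 1) ^ (2 * K) * d) * n)) *
        (regularSet d (Fin n)).ncard := by gcongr
    _ = _ := by ring

/-- Uniform random regular graphs are concentrated in small balls. -/
theorem exists_center (hd : 0 < d) {δ ε : ℝ} (hδ : 0 < δ) (hε : 0 < ε) :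
    ∃ N, ∀ n ≥ N, Nonempty (RegularGraph d n) → ∃ x : BoundedDegreeGraph d,
      (uniformRegular d n).real {G | δ < dist G.toBounded x} ≤ ε := by
  classical
  obtain ⟨K, t, η, hη, hctrl⟩ := BoundedDegreeGraph.exists_controlling_net d hδ
  -- The number κ is the deviation rate at t = η/2. Taking ρ = exp(-κ/2) below, the restriction to
  -- regular graphs costs only half of it.
  let κ : ℝ := (η / 2) ^ 2 / (128 * (d + 1) ^ (2 * K) * d)
  have hκ : 0 < κ := by positivity
  obtain ⟨c, hc, N, hN⟩ := exists_regularRatio_ge hd (Real.exp_pos (-(κ / 2)))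
    (Real.exp_lt_one_iff.2 (by linarith))
  let I := Σ (r : Fin K) (k : Fin K), t r k
  have hlim : Tendsto (fun n : ℕ => Fintype.card I * (2 / c * Real.exp (-(κ / 2)) ^ n)) atTop
      (𝓝 (Fintype.card I * (2 / c * 0))) :=
    ((tendsto_pow_atTop_nhds_zero_of_lt_one (Real.exp_pos _).le
      (Real.exp_lt_one_iff.2 (by linarith))).const_mul _).const_mul _
  rw [mul_zero, mul_zero] at hlim
  obtain ⟨N', hN'⟩ := eventually_atTop.1 (hlim.eventually_le_const hε)
  refine ⟨max N N', fun n hn hne => ?_⟩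
  have hratio := hN n (le_of_max_le_left hn) ⟨_, hne.some.mem_regularSet⟩
  choose μ hμ using fun i : I => exists_real_abs_infDist_sub_ge_le (n := n) hd
    (r := i.1 + 1) (K := K) i.1.2 (i.2.2 : Statistic (i.2.1 + 1)) (half_pos hη).le
  let B : I → Set (RegularGraph d n) := fun i =>
    {G | η / 2 ≤ |Metric.infDist (i.2.2 : Statistic (i.2.1 + 1))
      (G.toBounded.Q (i.1 + 1) (i.2.1 + 1)) - μ i|}
  have hB : (uniformRegular d n).real (⋃ i ∈ (Finset.univ : Finset I), B i) ≤ ε := by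
    refine le_trans ?_ (hN' n (le_of_max_le_right hn))
    refine (measureReal_biUnion_finset_le _ _).trans ?_
    rw [← nsmul_eq_mul, ← Finset.card_univ]
    refine Finset.sum_le_card_nsmul _ _ _ fun i _ => (hμ i).trans ?_
    have hpos : 0 < c * Real.exp (-(κ / 2)) ^ n := by positivity
    refine (div_le_div_of_nonneg_left (by positivity) hpos hratio).trans_eq ?_
    have : Real.exp (-(κ * n)) = Real.exp (-(κ / 2)) ^ n * Real.exp (-(κ / 2)) ^ n := by
      rw [← Real.exp_nat_mul, ← Real.exp_add]
      congr 1
      ring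
    change 2 * Real.exp (-(κ * n)) / _ = _
    rw [this]
    field_simp
  -- Any graph outside all bad events is a centre, since two such graphs differ by less than η/2 +
  -- η/2 in each control. If there is none, the bad events cover everything and any centre will do.
  by_cases hgood : ∃ G : RegularGraph d n, ∀ i, G ∉ B i
  · obtain ⟨G₀, hG₀⟩ := hgood
    refine ⟨G₀.toBounded, (measureReal_mono ?_ (measure_ne_top _ _)).trans hB⟩
    intro G hG
    by_contra hcon
    simp only [Finset.mem_univ, Set.iUnion_true, Set.mem_iUnion, not_exists] at hcon
    refine not_le_of_gt hG (hctrl _ _ fun r hr k hk q hq => ?_)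
    have h1 := hcon ⟨⟨r, hr⟩, ⟨k, hk⟩, ⟨q, hq⟩⟩
    have h2 := hG₀ ⟨⟨r, hr⟩, ⟨k, hk⟩, ⟨q, hq⟩⟩
    simp only [B, Set.mem_ofPred_eq, not_le] at h1 h2
    rw [abs_lt] at h1 h2 ⊢
    constructor <;> linarith [h1.1, h1.2, h2.1, h2.2]
  · refine ⟨hne.some.toBounded, (measureReal_mono ?_ (measure_ne_top _ _)).trans hB⟩
    intro G _
    by_contra hcon
    simp only [Finset.mem_univ, Set.iUnion_true, Set.mem_iUnion, not_exists] at hcon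
    exact hgood ⟨G, hcon⟩

end RegularGraph

/-! ### Borel–Cantelli and the accumulation point -/

/-- Independent uniform regular graphs converge along a sufficiently sparse set of sizes. -/
theorem ae_tendsto_of_measureReal_le {d : ℕ} {x : LimitSpace d} {m : ℕ → ℕ} (hm : StrictMono m)
    [hne : ∀ s : Set.range m, Nonempty (RegularGraph d s)]
    (h : ∀ j, (uniformRegular d (m j)).real
      {G | (1 / 2 : ℝ) ^ j < dist (G.toBounded : LimitSpace d) x} ≤ (1 / 2) ^ j) :
    ∀ᵐ G ∂(Measure.infinitePi fun s : Set.range m => uniformRegular d s),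
      Tendsto (fun s : Set.range m => ((G s).toBounded : LimitSpace d)) atTop (𝓝 x) := by
  let i : ℕ → Set.range m := fun j => ⟨m j, j, rfl⟩
  let E : ∀ j, Set (RegularGraph d (m j)) := fun j =>
    {G | (1 / 2 : ℝ) ^ j < dist (G.toBounded : LimitSpace d) x}
  let μ : Measure (∀ s : Set.range m, RegularGraph d s) :=
    Measure.infinitePi fun s : Set.range m => uniformRegular d s
  have hμ : ∀ j, μ (Function.eval (i j) ⁻¹' E j) ≤ ENNReal.ofReal ((1 / 2) ^ j) := by
    intro j
    have hp : IsProbabilityMeasure (uniformRegular d (m j)) :=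
      inferInstanceAs (IsProbabilityMeasure (uniformRegular d (i j)))
    have h1 := (measurePreserving_eval_infinitePi (fun s : Set.range m => uniformRegular d s)
      (i j)).measure_preimage (s := E j) (MeasurableSet.of_discrete).nullMeasurableSet
    refine h1.trans_le ?_
    refine (ENNReal.le_ofReal_iff_toReal_le (measure_ne_top (uniformRegular d (m j)) _)
      (by positivity)).2 (h j)
  have hsum : ∑' j, μ (Function.eval (i j) ⁻¹' E j) ≠ ∞ := by
    refine ne_top_of_le_ne_top ?_ (ENNReal.tsum_le_tsum hμ)
    rw [← ENNReal.ofReal_tsum_of_nonneg (fun _ => by positivity) summable_geometric_two]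
    exact ENNReal.ofReal_ne_top
  -- Borel–Cantelli: almost surely only finitely many of the graphs are farther than (1/2)^j from x.
  filter_upwards [ae_eventually_notMem hsum] with G hG
  rw [Metric.tendsto_nhds]
  intro ε hε
  have hlim : ∀ᶠ j : ℕ in atTop, (1 / 2 : ℝ) ^ j < ε :=
    (tendsto_pow_atTop_nhds_zero_of_lt_one (by norm_num) (by norm_num)).eventually_lt_const hε
  obtain ⟨J, hJ⟩ := eventually_atTop.1 (hG.and hlim)
  filter_upwards [eventually_ge_atTop (i J)] with s hs
  obtain ⟨_, j, rfl⟩ := s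
  obtain ⟨h1, h2⟩ := hJ j (hm.le_iff_le.1 hs)
  exact (not_lt.1 h1).trans_lt h2

/-- If independent uniform regular graphs concentrate at `x` for infinitely many sizes, then `x` is
represented by a typical graphing. -/
theorem exists_isTypical_represents {d : ℕ} {x : LimitSpace d}
    (h : ∀ δ > 0, ∃ᶠ m in atTop, Nonempty (RegularGraph d m) ∧
      (uniformRegular d m).real {G | δ < dist (G.toBounded : LimitSpace d) x} ≤ δ) :
    ∃ 𝒢 : Graphing d, 𝒢.IsTypical ∧ 𝒢.Represents x := by
  -- Strictly increasing sizes are chosen with radius and failure probability (1/2)^j, which are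
  -- summable.
  obtain ⟨m, hm, hm'⟩ := extraction_forall_of_frequently
    fun j : ℕ => h ((1 / 2) ^ j) (by positivity)
  obtain ⟨𝒢, h𝒢⟩ := exists_represents x
  have hne : ∀ s : Set.range m, Nonempty (RegularGraph d s) := by
    rintro ⟨_, j, rfl⟩
    exact (hm' j).1
  refine ⟨𝒢, ⟨Set.range m, Set.infinite_range_of_injective hm.injective, hne, ?_⟩, h𝒢⟩
  filter_upwards [ae_tendsto_of_measureReal_le hm fun j => (hm' j).2] with G hG
  exact h𝒢.lgTendsto hG

/-- Uniform regular graphs which meet a closed set with probability bounded below concentrate, for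
infinitely many sizes, at a point of that set. -/
theorem exists_concentration_point {d : ℕ} (hd : 0 < d) {n : ℕ → ℕ} (hn : Tendsto n atTop atTop)
    [hne : ∀ i, Nonempty (RegularGraph d (n i))] {C : Set (LimitSpace d)} (hC : IsClosed C) {ε : ℝ}
    (hε : 0 < ε) (hfreq : ∃ᶠ i in atTop,
      ε ≤ (uniformRegular d (n i)).real {G | (G.toBounded : LimitSpace d) ∈ C}) :
    ∃ x ∈ C, ∀ δ > 0, ∃ᶠ m in atTop, Nonempty (RegularGraph d m) ∧
      (uniformRegular d m).real {G | δ < dist (G.toBounded : LimitSpace d) x} ≤ δ := by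
  have hex : ∀ j : ℕ, ∃ i, ∃ y : BoundedDegreeGraph d, j ≤ n i ∧
      ε ≤ (uniformRegular d (n i)).real {G | (G.toBounded : LimitSpace d) ∈ C} ∧
      (uniformRegular d (n i)).real {G | 1 / ((j : ℝ) + 1) < dist G.toBounded y} ≤
        1 / ((j : ℝ) + 1) := by
    intro j
    have hj : (0 : ℝ) < 1 / ((j : ℝ) + 1) := by positivity
    obtain ⟨N, hN⟩ := RegularGraph.exists_center hd hj hj
    obtain ⟨i, hi, hi1, hi2⟩ := (hfreq.and_eventually
      ((hn.eventually_ge_atTop N).and (hn.eventually_ge_atTop j))).exists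
    obtain ⟨y, hy⟩ := hN (n i) hi1 (hne i)
    exact ⟨i, y, hi2, hi, hy⟩
  choose i y hij hiC hiy using hex
  obtain ⟨x, ψ, hψ, hx⟩ := CompactSpace.tendsto_subseq fun j => (y j : LimitSpace d)
  have key : ∀ δ > 0, ∀ᶠ j in atTop, (uniformRegular d (n (i (ψ j)))).real
      {G | δ < dist (G.toBounded : LimitSpace d) x} ≤ δ := by
    intro δ hδ
    have h1 : ∀ᶠ j : ℕ in atTop, 1 / (((ψ j : ℕ) : ℝ) + 1) < δ / 2 :=
      hψ.tendsto_atTop.eventually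
        ((tendsto_one_div_add_atTop_nhds_zero_nat (𝕜 := ℝ)).eventually_lt_const (half_pos hδ))
    filter_upwards [h1, Metric.tendsto_nhds.1 hx (δ / 2) (half_pos hδ)] with j hj1 hj2
    refine le_trans (measureReal_mono ?_ (measure_ne_top _ _)) ((hiy (ψ j)).trans (by linarith))
    intro G hG
    have h2 := dist_triangle (G.toBounded : LimitSpace d) (y (ψ j) : LimitSpace d) x
    rw [UniformSpace.Completion.dist_eq] at h2
    simp only [Set.mem_ofPred_eq, Function.comp_apply] at hG hj2 ⊢
    linarith
  refine ⟨x, ?_, fun δ hδ => ?_⟩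
  · by_contra hxC
    rw [← hC.closure_eq, Metric.mem_closure_iff] at hxC
    push Not at hxC
    obtain ⟨δ₀, hδ₀, hfar⟩ := hxC
    -- Every point of C is at distance at least δ₀ from x, so C would have probability at most ε/2,
    -- below the assumed ε.
    obtain ⟨j, hj⟩ := (key (min (δ₀ / 2) (ε / 2)) (by positivity)).exists
    have h1 : (uniformRegular d (n (i (ψ j)))).real {G | (G.toBounded : LimitSpace d) ∈ C} ≤
        (uniformRegular d (n (i (ψ j)))).real
          {G | min (δ₀ / 2) (ε / 2) < dist (G.toBounded : LimitSpace d) x} := by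
      refine measureReal_mono (fun G hG => ?_) (measure_ne_top _ _)
      have h2 := hfar _ hG
      rw [dist_comm] at h2
      exact (min_le_left _ _).trans_lt ((half_lt_self hδ₀).trans_le h2)
    have h3 := hiC (ψ j)
    have h4 := min_le_right (δ₀ / 2) (ε / 2)
    linarith
  · refine frequently_atTop.2 fun M => ?_
    obtain ⟨j, hj, hjM⟩ := ((key δ hδ).and (eventually_ge_atTop M)).exists
    -- The requirement j ≤ n i built into the choice of i makes the sizes unbounded.
    exact ⟨n (i (ψ j)), hjM.trans ((hψ.id_le j).trans (hij (ψ j))), hne _, hj⟩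

end LocalGlobal

end

theorem proposition2p9 (d : ℕ) (hd : 3 ≤ d)
    {Ω : Type*} [MeasurableSpace Ω] (P : MeasureTheory.Measure Ω)
    [MeasureTheory.IsProbabilityMeasure P]
    (n : ℕ → ℕ) (hn : Filter.Tendsto n Filter.atTop Filter.atTop)
    (𝔾 : (i : ℕ) → Ω → LocalGlobal.RegularGraph d (n i))
    (hlaw : ∀ i, ProbabilityTheory.HasLaw (𝔾 i) (LocalGlobal.uniformRegular d (n i)) P)
    (hindep : ProbabilityTheory.iIndepFun 𝔾 P)
    (C : Set (LocalGlobal.LimitSpace d)) (hC : IsClosed C)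
    (hCtyp : ∀ 𝒢 : LocalGlobal.Graphing d, 𝒢.IsTypical → ∀ x ∈ C, ¬ 𝒢.Represents x) :
    Filter.Tendsto
      (fun i => P {ω | ((𝔾 i ω).toBounded : LocalGlobal.LimitSpace d) ∈ C})
      Filter.atTop (nhds 0) := by
  -- A probability space has a point, and the value of 𝔾 i there is a regular graph on n i vertices.
  have hne : ∀ i, Nonempty (LocalGlobal.RegularGraph d (n i)) := fun i =>
    (MeasureTheory.nonempty_of_isProbabilityMeasure P).map (𝔾 i)
  have hP : ∀ i, P {ω | ((𝔾 i ω).toBounded : LocalGlobal.LimitSpace d) ∈ C} =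
      LocalGlobal.uniformRegular d (n i)
        {G | (G.toBounded : LocalGlobal.LimitSpace d) ∈ C} := by
    intro i
    rw [← (hlaw i).map_eq, Measure.map_apply_of_aemeasurable (hlaw i).aemeasurable
      MeasurableSet.of_discrete]
    rfl
  simp_rw [hP]
  rw [← ENNReal.tendsto_toReal_iff (fun i => measure_ne_top _ _) ENNReal.zero_ne_top]
  by_contra hcon
  rw [Metric.tendsto_nhds] at hcon
  push Not at hcon
  obtain ⟨ε, hε, hfreq⟩ := hcon
  obtain ⟨x, hx, hconc⟩ := LocalGlobal.exists_concentration_point (by omega) hn hC hε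
    (hfreq.mono fun i hi => by
      rwa [ENNReal.toReal_zero, Real.dist_eq, sub_zero, abs_of_nonneg ENNReal.toReal_nonneg] at hi)
  obtain ⟨𝒢, htyp, hrep⟩ := LocalGlobal.exists_isTypical_represents hconc
  exact hCtyp 𝒢 htyp x hx hrep
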